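/- **Construction of $T_v$.** Let $v=(k_n,\ell_n,m_n)_{n\ge 0}$ with integers $k_n\ge 1$, $\ell_n\ge 0$, $m_n\ge 1$. The column $C_0$ is the single interval $I_0=[0,1)$, of height $h_0=1$ and width $w_0=1$. Given a column $C_n$ of height $h_n$ (an ordered list of $h_n$ disjoint intervals, its levels, of equal width $w_n$), cut it into $k_n$ subcolumns of equal width and put $\ell_n$ spacers (new intervals) on top of each of the first $k_n-1$ subcolumns. Stack these $k_n-1$ subcolumns from left to right, cut the resulting stack into $m_n$ subcolumns of equal width and stack these from left to right. Cut the last subcolumn of $C_n$ (without spacers) into $m_n$ subcolumns of equal width and stack these from left to right. Put this second stack on top of the first one, and add on top as many spacers as there are levels so far. The result is the column $C_{n+1}$, of height $$h_{n+1}=2m_n(h_n+\ell_n)(k_n-1)+2m_nh_n$$ and width $w_{n+1}=w_n/(k_nm_n)$. All intervals are closed on the left and open on the right, and new spacers are taken consecutively to the right of the intervals already used. Let $X=\bigcup_n C_n$ with Lebesgue measure $\mu$, and let $T_v:X\to X$ map each level of each column, except the top one, by translation onto the level directly above it. Put $H_n=h_n+\ell_n$. For $0<\alpha<1$ let $V_\alpha$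 be the class of all $T_v$ with $k_n=n+1$, $\ell_n=\lfloor n^\alpha\rfloor h_n$ for all $n\ge 0$, and $\lim_{n\to\infty}\lfloor n^\alpha\rfloor/m_n=0$. For $\beta>1$, a transformation $T$ of a measure space $(X,\mu)$ is called $\beta$-rationally ergodic if it is conservative and ergodic and there is a set $F$ of positive finite measure with $$\liminf_{n\to\infty}\frac{\left(\int_F\sum_{i=0}^{n-1}1_F(T^ix)\,d\mu\right)^\beta}{\int_F\left(\sum_{i=0}^{n-1}1_F(T^ix)\right)^\beta d\mu}>0.$$ **Theorem.** Let $\alpha,\beta\in\mathbb R$ with $0<\alpha<1$ and $\alpha\beta>1$, and let $T=T_v\in V_\alpha$. Then for every set $F$ of positive finite measure, $$\liminf_{n\to\infty}\frac{\left(\int_F\sum_{i=0}^{H_n-1}1_F(T^ix)\,d\mu\right)^\beta}{\int_F\left(\sum_{i=0}^{H_n-1}1_F(T^ix)\right)^\beta d\mu}=0.$$ In particular, $T$ is not $\beta$-rationally ergodic. -/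

import Mathlib

/-- Parameters `v = (k_n, ℓ_n, m_n)` of the cutting and stacking construction. At stage `n` the
column is cut into `k n` pieces, and later each piece into `m n` pieces, so both are positive. -/
structure CutStack where
  k : ℕ → ℕ
  l : ℕ → ℕ
  m : ℕ → ℕ
  k_pos : ∀ n, 0 < k n
  m_pos : ∀ n, 0 < m n

namespace CutStack

/-- The height `h_n` of the column `C_n`. -/
def h (v : CutStack) : ℕ → ℕ
  | 0 => 1
  | n + 1 => 2 * v.m n * (v.h n + v.l n) * (v.k n - 1) + 2 * v.m n * v.h n

/-- `H_n = h_n + ℓ_n`. -/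
def H (v : CutStack) (n : ℕ) : ℕ := v.h n + v.l n

/-- The common width of the levels of `C_n`; the initial interval `I_0 = [0, 1)` has length one. -/
noncomputable def w (v : CutStack) : ℕ → ℝ
  | 0 => 1
  | n + 1 => v.w n / (v.k n * v.m n)

/-- Left endpoints of the levels of the `i`-th subcolumn of `C_n`, of width `w_n / k_n`, together
with the `ℓ_n` spacers on top of it (used for `i < k_n - 1`), counted from the bottom. Here
`a s` is the left endpoint of level `s` of `C_n`. Spacers are new intervals, taken one after the
other to the right of `C_n = [0, h_n w_n)`. -/
noncomputable def barLeft (v : CutStack) (n : ℕ) (a : ℕ → ℝ) (i s : ℕ) : ℝ :=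
  if s < v.h n then a s + i * (v.w n / v.k n)
  else v.h n * v.w n + (i * v.l n + (s - v.h n) : ℕ) * (v.w n / v.k n)

/-- `v.left n s` is the left endpoint of the level number `s` (from the bottom, `s < h_n`) of the
column `C_n`. The column `C_{n+1}` consists, from bottom to top, of

* `m_n` pieces of the stack of the first `k_n - 1` subcolumns of `C_n` with `ℓ_n` spacers on top
  of each of them: level `t` lies in piece `j = t / (H_n (k_n - 1))`, in subcolumn
  `i = (t / H_n) % (k_n - 1)`, at height `t % H_n`;
* `m_n` pieces of the last subcolumn of `C_n`, without spacers;
* as many further spacers as there are levels so far. -/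
noncomputable def left (v : CutStack) : ℕ → ℕ → ℝ
  | 0, _ => 0
  | n + 1, t =>
    let A := v.m n * (v.k n - 1) * v.H n
    let B := v.m n * v.h n
    if t < A then
      v.barLeft n (v.left n) ((t / v.H n) % (v.k n - 1)) (t % v.H n)
        + (t / (v.H n * (v.k n - 1)) : ℕ) * v.w (n + 1)
    else if t < A + B then
      v.left n ((t - A) % v.h n) + (v.k n - 1 : ℕ) * (v.w n / v.k n)
        + ((t - A) / v.h n : ℕ) * v.w (n + 1)
    else
      v.h n * v.w n + ((v.k n - 1) * v.l n : ℕ) * (v.w n / v.k n)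
        + (t - (A + B) : ℕ) * v.w (n + 1)

/-- Level number `s` of the column `C_n`. -/
def level (v : CutStack) (n s : ℕ) : Set ℝ :=
  Set.Ico (v.left n s) (v.left n s + v.w n)

/-- The column `C_n`, as a set of points. -/
def column (v : CutStack) (n : ℕ) : Set ℝ := ⋃ s ∈ Finset.range (v.h n), v.level n s

/-- The space `X`, the union of all columns. -/
def X (v : CutStack) : Set ℝ := ⋃ n, v.column n

/-- Lebesgue measure on `X`. -/
noncomputable def μ (v : CutStack) : MeasureTheory.Measure ℝ :=
  MeasureTheory.volume.restrict v.X

open Classical in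
/-- The transformation `T_v`: on each level of each column, except the top one, it is the
translation onto the level directly above. (The translations given by different columns agree, and
every point of `X` lies below the top level of some column. Points outside `X` are a null set for
`v.μ` and are fixed.) -/
noncomputable def T (v : CutStack) (x : ℝ) : ℝ :=
  if hx : ∃ p : ℕ × ℕ, p.2 + 1 < v.h p.1 ∧ x ∈ v.level p.1 p.2 then
    x + (v.left hx.choose.1 (hx.choose.2 + 1) - v.left hx.choose.1 hx.choose.2)
  else x

/-- The parameters of the class `V_α`: `k_n = n + 1`, `ℓ_n = ⌊n ^ α⌋ h_n`, and
`⌊n ^ α⌋ / m_n → 0`. The transformations in `V_α` are the `v.T` for these `v`. -/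
def VAlpha (α : ℝ) : Set CutStack :=
  {v | (∀ n, v.k n = n + 1) ∧ (∀ n, v.l n = ⌊(n : ℝ) ^ α⌋₊ * v.h n) ∧
    Filter.Tendsto (fun n : ℕ => (⌊(n : ℝ) ^ α⌋₊ : ℝ) / (v.m n : ℝ)) Filter.atTop (nhds 0)}

end CutStack

open scoped ENNReal in
/-- The number of visits `∑_{i < n} 1_F (T ^ i x)`. -/
noncomputable def visits {Ω : Type*} (T : Ω → Ω) (F : Set Ω) (n : ℕ) (x : Ω) : ℝ≥0∞ :=
  ∑ i ∈ Finset.range n, F.indicator 1 (T^[i] x)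

open scoped ENNReal in
/-- `(∫_F ∑_{i < n} 1_F (T ^ i x) dμ) ^ β / ∫_F (∑_{i < n} 1_F (T ^ i x)) ^ β dμ`. -/
noncomputable def visitRatio {Ω : Type*} [MeasurableSpace Ω] (μ : MeasureTheory.Measure Ω)
    (T : Ω → Ω) (β : ℝ) (F : Set Ω) (n : ℕ) : ℝ≥0∞ :=
  (∫⁻ x in F, visits T F n x ∂μ) ^ β / ∫⁻ x in F, visits T F n x ^ β ∂μ

/-- `T` is `β`-rationally ergodic: conservative, ergodic, and the lower limit of the ratios is
positive for some set of positive finite measure. -/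
def RationallyErgodic {Ω : Type*} [MeasurableSpace Ω] (μ : MeasureTheory.Measure Ω)
    (T : Ω → Ω) (β : ℝ) : Prop :=
  MeasureTheory.Conservative T μ ∧ Ergodic T μ ∧
    ∃ F : Set Ω, MeasureTheory.NullMeasurableSet F μ ∧ μ F ≠ 0 ∧ μ F ≠ ⊤ ∧
      0 < Filter.liminf (fun n : ℕ => visitRatio μ T β F n) Filter.atTop

/-!
Write `c(x)` for the number of visits of the orbit of `x` to `F` before time `H_n`, `N = ∫_F c` and
`D = ∫_F c ^ β`; the ratio in question is `N ^ β / D`. Since `T` preserves the measure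
(`CutStack.measurePreserving_T`), integrals over `F` can be compared with integrals over the whole
space: counting the visits in an orbit segment from its end gives
`∫ c ^ (p + 1) ≤ (p + 1) H_n ∫_F c ^ p` (`lintegral_visits_rpow_le`), and conversely
`H_n N ≤ 3 ∫ c ^ 2` (`mul_setLIntegral_visits_le`).

*Lower bound for `D`.* In `C_{n+1}` the copies of the last subcolumn of `C_n` follow each other
without spacers. The part of `F` in this subcolumn is therefore visited `q = 1 + ⌊n ^ α⌋` times as
densely as usual: Hölder's inequality on the stack of these copies, which is longer than `H_n`
because `⌊n ^ α⌋ / m_n → 0`, bounds `D` below by a constant times `(q / w_n) ^ β / k_n`, as soon as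
`F` meets the last subcolumn in a set of measure at least a constant times `1 / k_n`
(`CutStack.rpow_mul_volume_inter_lastPart_le`). The latter holds for infinitely many `n`, since
the last subcolumns are pairwise independent in each fixed column and `∑ 1 / k_n` diverges
(`frequently_measureReal_inter_ge`).

*Upper bound for `N`.* Let `E` be a column `C_N` such that `F \ E` has small measure. The visits that
involve `F \ E` contribute to `N` at most a small multiple of `D ^ (1 / β)`, by Hölder's inequality
(`setLIntegral_visits_le`). For `E` itself, a window of `H_n` levels of `C_{n+1}` sees
`f = μ(E) / w_n` levels in `E` if it lies in the stack of the first subcolumns, and at most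
`(1 + q) f` otherwise. The second case concerns a proportion of order `1 / k_n` of the points of
`E`, and `q ≤ k_n` because `α < 1`, so the contribution of `E` is of order `1 / w_n`
(`CutStack.setLIntegral_visits_levels_le`).

Hence `N / D ^ (1 / β)` is, for infinitely many `n`, at most a small constant plus a multiple of
`k_n ^ (1 / β) / q`, which is of order `n ^ (1 / β - α)` and tends to zero because `α β > 1`. As
`H_n → ∞`, no set can witness rational ergodicity.
-/

open MeasureTheory Filter Topology
open scoped ENNReal

/-! ### Visit counts of measure preserving transformations -/

section Visits

variable {Ω : Type*} {T : Ω → Ω}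

theorem visits_succ (T : Ω → Ω) (F : Set Ω) (n : ℕ) (x : Ω) :
    visits T F (n + 1) x = F.indicator 1 x + visits T F n (T x) := by
  simp only [visits, Finset.sum_range_succ', Function.iterate_zero, id,
    Function.iterate_succ_apply]
  rw [add_comm]

theorem visits_add (T : Ω → Ω) (F : Set Ω) (m n : ℕ) (x : Ω) :
    visits T F (m + n) x = visits T F m x + visits T F n (T^[m] x) := by
  simp only [visits, Finset.sum_range_add]
  congr 1
  refine Finset.sum_congr rfl fun i _ => ?_
  rw [add_comm m i, Function.iterate_add_apply]

theorem visits_mono (T : Ω → Ω) (F : Set Ω) {m n : ℕ} (h : m ≤ n) (x : Ω) :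
    visits T F m x ≤ visits T F n x := by
  obtain ⟨k, rfl⟩ := Nat.exists_eq_add_of_le h
  rw [visits_add]
  exact le_self_add

theorem visits_le (T : Ω → Ω) (F : Set Ω) (n : ℕ) (x : Ω) : visits T F n x ≤ n := by
  calc visits T F n x ≤ ∑ _i ∈ Finset.range n, (1 : ℝ≥0∞) :=
        Finset.sum_le_sum fun i _ => Set.indicator_le_self' (by simp) _
    _ = n := by simp

theorem visits_ne_top (T : Ω → Ω) (F : Set Ω) (n : ℕ) (x : Ω) : visits T F n x ≠ ⊤ :=
  ne_top_of_le_ne_top (by simp) (visits_le T F n x)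

theorem visits_inter_add_diff (T : Ω → Ω) (F E : Set Ω) (n : ℕ) (x : Ω) :
    visits T (F ∩ E) n x + visits T (F \ E) n x = visits T F n x := by
  simp only [visits, ← Finset.sum_add_distrib]
  refine Finset.sum_congr rfl fun i _ => ?_
  by_cases h1 : T^[i] x ∈ F <;> by_cases h2 : T^[i] x ∈ E <;> simp [h1, h2]

/-- Bernoulli's inequality in the form `(1 + b) ^ (p + 1) ≤ b ^ (p + 1) + (p + 1) (1 + b) ^ p`. -/
theorem one_add_rpow_le {b : ℝ≥0∞} (hb : b ≠ ⊤) {p : ℝ} (hp : 0 ≤ p) :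
    (1 + b) ^ (p + 1) ≤ b ^ (p + 1) + ENNReal.ofReal (p + 1) * (1 + b) ^ p := by
  lift b to NNReal using hb
  have hb0 : (0 : ℝ) ≤ b := b.2
  have key : (1 + (b : ℝ)) ^ (p + 1) ≤ (b : ℝ) ^ (p + 1) + (p + 1) * (1 + (b : ℝ)) ^ p := by
    have hy : 0 < 1 + (b : ℝ) := by positivity
    have h1 := one_add_mul_self_le_rpow_one_add (s := -(1 / (1 + (b : ℝ))))
      (by rw [neg_le_neg_iff, div_le_one hy]; linarith) (p := p + 1) (by linarith)
    have h2 : 1 + -(1 / (1 + (b : ℝ))) = b / (1 + b) := by field_simp; ring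
    rw [h2, Real.div_rpow hb0 hy.le, le_div_iff₀ (by positivity)] at h1
    have h3 : (1 + (b : ℝ)) ^ (p + 1) = (1 + (b : ℝ)) ^ p * (1 + b) := by
      rw [Real.rpow_add hy, Real.rpow_one]
    rw [h3] at h1 ⊢
    have h4 : (1 + (p + 1) * -(1 / (1 + (b : ℝ)))) * ((1 + (b : ℝ)) ^ p * (1 + b))
        = (1 + (b : ℝ)) ^ p * (1 + b) - (p + 1) * (1 + (b : ℝ)) ^ p := by
      field_simp; ring
    linarith
  rw [← ENNReal.ofReal_coe_nnreal, ← ENNReal.ofReal_one, ← ENNReal.ofReal_add zero_le_one hb0,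
    ENNReal.ofReal_rpow_of_nonneg (by positivity) (by positivity),
    ENNReal.ofReal_rpow_of_nonneg (by positivity) (by positivity),
    ENNReal.ofReal_rpow_of_nonneg (by positivity) (by positivity),
    ← ENNReal.ofReal_mul (by positivity), ← ENNReal.ofReal_add (by positivity) (by positivity)]
  exact ENNReal.ofReal_le_ofReal key

/-- If an orbit segment has `b` visits to `F`, then the `i`-th visit counted from the end is
followed by `i - 1` further ones, so `∑ (number of visits from then on) ^ p` over the visits is
`1 ^ p + ⋯ + b ^ p ≥ b ^ (p + 1) / (p + 1)`. -/
theorem visits_rpow_le (T : Ω → Ω) (F : Set Ω) {p : ℝ} (hp : 0 ≤ p) (n : ℕ) (x : Ω) :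
    visits T F n x ^ (p + 1) ≤ ENNReal.ofReal (p + 1) *
      ∑ i ∈ Finset.range n, F.indicator (fun y => visits T F n y ^ p) (T^[i] x) := by
  have main : ∀ n x, visits T F n x ^ (p + 1) ≤ ENNReal.ofReal (p + 1) *
      ∑ i ∈ Finset.range n, F.indicator (fun y => visits T F (n - i) y ^ p) (T^[i] x) := by
    intro n
    induction n with
    | zero => intro x; simp [visits, ENNReal.zero_rpow_of_pos (by linarith : 0 < p + 1)]
    | succ n ih =>
      intro x
      rw [Finset.sum_range_succ', mul_add]
      have h1 : ∑ i ∈ Finset.range n,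
          F.indicator (fun y => visits T F (n + 1 - (i + 1)) y ^ p) (T^[i + 1] x)
          = ∑ i ∈ Finset.range n,
          F.indicator (fun y => visits T F (n - i) y ^ p) (T^[i] (T x)) := by
        refine Finset.sum_congr rfl fun i _ => ?_
        rw [Nat.add_sub_add_right, Function.iterate_succ_apply]
      rw [h1]
      refine le_trans ?_ (add_le_add_left (ih (T x)) _)
      by_cases hx : x ∈ F
      · have h2 : visits T F (n + 1) x = 1 + visits T F n (T x) := by
          rw [visits_succ]; simp [hx]
        simp only [Function.iterate_zero, id, Set.indicator_of_mem hx, Nat.sub_zero, h2]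
        exact one_add_rpow_le (visits_ne_top _ _ _ _) hp
      · rw [visits_succ]
        simp [hx]
  refine (main n x).trans ?_
  gcongr with i hi
  exact visits_mono T F (Nat.sub_le _ _) _

variable [MeasurableSpace Ω] {μ : Measure Ω}

theorem measurable_visits (hT : Measurable T) {F : Set Ω} (hF : MeasurableSet F) (n : ℕ) :
    Measurable (visits T F n) := by
  unfold visits
  refine Finset.measurable_fun_sum _ fun i _ => ?_
  exact (measurable_one.indicator hF).comp (hT.iterate i)

theorem lintegral_sum_iterate (hT : MeasurePreserving T μ μ) {f : Ω → ℝ≥0∞}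
    (hf : Measurable f) (n : ℕ) :
    ∫⁻ x, ∑ i ∈ Finset.range n, f (T^[i] x) ∂μ = n * ∫⁻ x, f x ∂μ := by
  rw [lintegral_finsetSum (f := fun i x => f (T^[i] x)) _
    fun i _ => hf.comp (hT.measurable.iterate i),
    Finset.sum_congr rfl fun i _ => (hT.iterate i).lintegral_comp hf]
  simp

theorem lintegral_visits (hT : MeasurePreserving T μ μ) {F : Set Ω} (hF : MeasurableSet F)
    (n : ℕ) : ∫⁻ x, visits T F n x ∂μ = n * μ F := by
  unfold visits
  rw [lintegral_sum_iterate hT (measurable_one.indicator hF), lintegral_indicator_one hF]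

/-- `∫_Ω (visits) ^ (p + 1) ≤ (p + 1) n ∫_F (visits) ^ p`, where visits to `F` are counted up to
time `n`. -/
theorem lintegral_visits_rpow_le (hT : MeasurePreserving T μ μ) {F : Set Ω}
    (hF : MeasurableSet F) {p : ℝ} (hp : 0 ≤ p) (n : ℕ) :
    ∫⁻ x, visits T F n x ^ (p + 1) ∂μ ≤
      ENNReal.ofReal (p + 1) * (n * ∫⁻ x in F, visits T F n x ^ p ∂μ) := by
  have hm : Measurable (F.indicator fun y => visits T F n y ^ p) :=
    ((measurable_visits hT.measurable hF n).pow_const p).indicator hF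
  refine (lintegral_mono (visits_rpow_le T F hp n)).trans_eq ?_
  rw [lintegral_const_mul' _ _ ENNReal.ofReal_ne_top, lintegral_sum_iterate hT hm,
    lintegral_indicator hF]

/-- A converse estimate: `n ∫_F (visits) ≤ 3 ∫_Ω (visits) ^ 2`. -/
theorem mul_setLIntegral_visits_le (hT : MeasurePreserving T μ μ) {F : Set Ω}
    (hF : MeasurableSet F) (n : ℕ) :
    n * ∫⁻ x in F, visits T F n x ∂μ ≤ 3 * ∫⁻ x, visits T F n x ^ 2 ∂μ := by
  have hv := measurable_visits hT.measurable hF n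
  have hm : Measurable (F.indicator (visits T F n)) := hv.indicator hF
  have h1 : n * ∫⁻ x in F, visits T F n x ∂μ
      = ∫⁻ x, ∑ i ∈ Finset.range n, F.indicator (visits T F n) (T^[i] x) ∂μ := by
    rw [lintegral_sum_iterate hT hm, lintegral_indicator hF]
  -- every visit before time `n` is followed by at most `visits T F (n + n)` visits
  have h2 : ∀ x, ∑ i ∈ Finset.range n, F.indicator (visits T F n) (T^[i] x)
      ≤ 2 * visits T F n x ^ 2 + visits T F n (T^[n] x) ^ 2 := by
    intro x
    have h3 : ∑ i ∈ Finset.range n, F.indicator (visits T F n) (T^[i] x)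
        ≤ visits T F n x * visits T F (n + n) x := by
      rw [visits, Finset.sum_mul]
      refine Finset.sum_le_sum fun i hi => ?_
      by_cases hx : T^[i] x ∈ F
      · have h4 := visits_mono T F
          (show i + n ≤ n + n by have := Finset.mem_range.1 hi; omega) x
        rw [visits_add] at h4
        simpa [hx] using le_trans le_add_self h4
      · simp [hx]
    refine h3.trans ?_
    rw [visits_add]
    generalize visits T F n x = a
    generalize visits T F n (T^[n] x) = b
    have h5 : a * b ≤ a ^ 2 + b ^ 2 := by
      rcases le_total a b with h | h
      · calc a * b ≤ b * b := by gcongr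
          _ = b ^ 2 := (sq b).symm
          _ ≤ _ := le_add_self
      · calc a * b ≤ a * a := by gcongr
          _ = a ^ 2 := (sq a).symm
          _ ≤ _ := le_self_add
    calc a * (a + b) = a ^ 2 + a * b := by ring
      _ ≤ a ^ 2 + (a ^ 2 + b ^ 2) := by gcongr
      _ = _ := by ring
  rw [h1]
  refine (lintegral_mono h2).trans_eq ?_
  rw [lintegral_add_left ((hv.pow_const 2).const_mul 2), lintegral_const_mul _ (hv.pow_const 2),
    (hT.iterate n).lintegral_comp (f := fun y => visits T F n y ^ 2) (hv.pow_const 2)]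
  ring

/-- The part of `F` outside `E` contributes little to the integral of the visit counts if
`μ (F \ E)` is small, relative to the integral of their `β`-th powers. -/
theorem setLIntegral_visits_le (hT : MeasurePreserving T μ μ) {F E : Set Ω}
    (hF : MeasurableSet F) (hE : MeasurableSet E) {β : ℝ} (hβ : 1 < β) {n : ℕ} (hn : n ≠ 0) :
    ∫⁻ x in F, visits T F n x ∂μ ≤ 6 * ∫⁻ x in F ∩ E, visits T (F ∩ E) n x ∂μ +
      6 * (μ (F \ E) ^ (1 - 1 / β) *
        (ENNReal.ofReal (β + 1) * ∫⁻ x in F, visits T F n x ^ β ∂μ) ^ (1 / β)) := by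
  have hβ0 : 0 < β := by linarith
  set D := ∫⁻ x in F, visits T F n x ^ β ∂μ
  set N' := ∫⁻ x in F ∩ E, visits T (F ∩ E) n x ∂μ
  have mc := measurable_visits hT.measurable hF n
  have mc' := measurable_visits hT.measurable (hF.inter hE) n
  have mc'' := measurable_visits hT.measurable (hF.diff hE) n
  have e1 : 1 - 1 / β + 1 / β = 1 := by ring
  have i1 : 0 ≤ 1 / β := by positivity
  have i2 : 0 ≤ 1 - 1 / β := by
    rw [sub_nonneg, div_le_one hβ0]; exact hβ.le
  -- Hölder's inequality with the weight `visits T (F \ E) n`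
  have hold : ∫⁻ x, visits T (F \ E) n x * visits T F n x ∂μ
      ≤ n * (μ (F \ E) ^ (1 - 1 / β) * (ENNReal.ofReal (β + 1) * D) ^ (1 / β)) := by
    calc ∫⁻ x, visits T (F \ E) n x * visits T F n x ∂μ
        ≤ ∫⁻ x, visits T (F \ E) n x ^ (1 - 1 / β) * (visits T F n x ^ (β + 1)) ^ (1 / β) ∂μ := by
          refine lintegral_mono fun x => ?_
          set a := visits T (F \ E) n x
          set b := visits T F n x
          have hab : a ≤ b := by
            rw [show b = _ from (visits_inter_add_diff T F E n x).symm]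
            exact le_add_self
          calc a * b = a ^ (1 - 1 / β + 1 / β) * b := by rw [e1, ENNReal.rpow_one]
            _ = a ^ (1 - 1 / β) * (a ^ (1 / β) * b) := by
              rw [ENNReal.rpow_add_of_nonneg _ _ i2 i1, mul_assoc]
            _ ≤ a ^ (1 - 1 / β) * (b ^ (1 / β) * b) := by gcongr
            _ = a ^ (1 - 1 / β) * (b ^ (β + 1)) ^ (1 / β) := by
              rw [← ENNReal.rpow_mul, show (β + 1) * (1 / β) = 1 / β + 1 by field_simp; ring,
                ENNReal.rpow_add_of_nonneg _ _ i1 zero_le_one, ENNReal.rpow_one]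
      _ ≤ (∫⁻ x, visits T (F \ E) n x ∂μ) ^ (1 - 1 / β) *
          (∫⁻ x, visits T F n x ^ (β + 1) ∂μ) ^ (1 / β) :=
          ENNReal.lintegral_mul_norm_pow_le mc''.aemeasurable (mc.pow_const _).aemeasurable
            i2 i1 e1
      _ ≤ (n * μ (F \ E)) ^ (1 - 1 / β) * (n * (ENNReal.ofReal (β + 1) * D)) ^ (1 / β) := by
          rw [lintegral_visits hT (hF.diff hE)]
          gcongr
          refine (lintegral_visits_rpow_le hT hF hβ0.le n).trans_eq ?_
          ring
      _ = n ^ (1 - 1 / β + 1 / β) *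
          (μ (F \ E) ^ (1 - 1 / β) * (ENNReal.ofReal (β + 1) * D) ^ (1 / β)) := by
          rw [ENNReal.mul_rpow_of_nonneg _ _ i2, ENNReal.mul_rpow_of_nonneg _ _ i1,
            ENNReal.rpow_add_of_nonneg _ _ i2 i1]
          ring
      _ = _ := by rw [e1, ENNReal.rpow_one]
  have hsq : ∫⁻ x, visits T (F ∩ E) n x ^ 2 ∂μ ≤ 2 * (n * N') := by
    have := lintegral_visits_rpow_le hT (hF.inter hE) zero_le_one n
    simp only [ENNReal.rpow_one, one_add_one_eq_two, ENNReal.rpow_two] at this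
    simpa using this
  have hc : ∫⁻ x, visits T F n x ^ 2 ∂μ ≤ ∫⁻ x, visits T (F ∩ E) n x ^ 2 ∂μ +
      2 * ∫⁻ x, visits T (F \ E) n x * visits T F n x ∂μ := by
    rw [← lintegral_const_mul' _ _ ENNReal.ofNat_ne_top, ← lintegral_add_left (mc'.pow_const 2)]
    refine lintegral_mono fun x => ?_
    simp only [← visits_inter_add_diff T F E n x]
    generalize visits T (F ∩ E) n x = a
    generalize visits T (F \ E) n x = b
    calc (a + b) ^ 2 = a ^ 2 + 2 * (b * a) + b ^ 2 := by ring
      _ ≤ a ^ 2 + 2 * (b * a) + b ^ 2 + b ^ 2 := le_self_add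
      _ = _ := by ring
  have hn0 : (n : ℝ≥0∞) ≠ 0 := by exact_mod_cast hn
  have hnt : (n : ℝ≥0∞) ≠ ⊤ := by simp
  rw [← ENNReal.mul_le_mul_iff_right hn0 hnt]
  calc _ ≤ 3 * ∫⁻ x, visits T F n x ^ 2 ∂μ := mul_setLIntegral_visits_le hT hF n
    _ ≤ 3 * (2 * (n * N') +
        2 * (n * (μ (F \ E) ^ (1 - 1 / β) * (ENNReal.ofReal (β + 1) * D) ^ (1 / β)))) := by
        gcongr
        exact hc.trans (by gcongr)
    _ = _ := by ring

/-- A lower bound for the integral of the `β`-th powers of the visit counts, in terms of their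
integral over a set `Z`. -/
theorem setLIntegral_visits_rpow_le (hT : MeasurePreserving T μ μ) {F : Set Ω}
    (hF : MeasurableSet F) {β : ℝ} (hβ : 0 < β) (n : ℕ) (Z : Set Ω) :
    (∫⁻ x in Z, visits T F n x ∂μ) ^ (β + 1) ≤
      μ Z ^ β * (ENNReal.ofReal (β + 1) * (n * ∫⁻ x in F, visits T F n x ^ β ∂μ)) := by
  have mc := measurable_visits hT.measurable hF n
  have i0 : 0 < β + 1 := by linarith
  have h1 : ∫⁻ x in Z, visits T F n x ∂μ ≤ μ Z ^ (β / (β + 1)) *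
      (∫⁻ x in Z, visits T F n x ^ (β + 1) ∂μ) ^ (1 / (β + 1)) := by
    have := ENNReal.lintegral_mul_norm_pow_le (μ := μ.restrict Z) (f := 1)
      (g := fun x => visits T F n x ^ (β + 1)) (p := β / (β + 1)) (q := 1 / (β + 1))
      aemeasurable_one (mc.pow_const _).aemeasurable
      (by positivity) (by positivity) (by field_simp)
    simpa [← ENNReal.rpow_mul, i0.ne'] using this
  calc _ ≤ (μ Z ^ (β / (β + 1)) *
      (∫⁻ x in Z, visits T F n x ^ (β + 1) ∂μ) ^ (1 / (β + 1))) ^ (β + 1) := by gcongr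
    _ = μ Z ^ β * ∫⁻ x in Z, visits T F n x ^ (β + 1) ∂μ := by
      rw [ENNReal.mul_rpow_of_nonneg _ _ i0.le, ← ENNReal.rpow_mul, ← ENNReal.rpow_mul,
        div_mul_cancel₀ _ i0.ne', div_mul_cancel₀ _ i0.ne', ENNReal.rpow_one]
    _ ≤ _ := by
      gcongr
      exact (setLIntegral_le_lintegral _ _).trans (lintegral_visits_rpow_le hT hF hβ.le n)

end Visits

namespace CutStack

variable (v : CutStack)

/-! ### Positions of the levels -/

/-- The number of levels of `C_{n+1}` in the `m_n` pieces of the stack of the first `k_n - 1`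
subcolumns of `C_n`, spacers included. -/
def firstLen (n : ℕ) : ℕ := v.m n * (v.k n - 1) * v.H n

/-- The number of levels of `C_{n+1}` in the `m_n` pieces of the last subcolumn of `C_n`. -/
def lastLen (n : ℕ) : ℕ := v.m n * v.h n

/-- The levels of `C_n` are the intervals `[p w_n, (p + 1) w_n)` with `p < h_n`, in some order;
`v.pos n s` is the number `p` that belongs to level `s`. -/
def pos (v : CutStack) : ℕ → ℕ → ℕ
  | 0, _ => 0
  | n + 1, t =>
    if t < v.firstLen n then
      (if t % v.H n < v.h n then
        v.pos n (t % v.H n) * (v.k n * v.m n) + (t / v.H n % (v.k n - 1)) * v.m n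
      else v.h n * (v.k n * v.m n) +
        (t / v.H n % (v.k n - 1) * v.l n + (t % v.H n - v.h n)) * v.m n)
        + t / (v.H n * (v.k n - 1))
    else if t < v.firstLen n + v.lastLen n then
      v.pos n ((t - v.firstLen n) % v.h n) * (v.k n * v.m n) + (v.k n - 1) * v.m n
        + (t - v.firstLen n) / v.h n
    else v.h n * (v.k n * v.m n) + (v.k n - 1) * v.l n * v.m n
      + (t - (v.firstLen n + v.lastLen n))

theorem h_succ (n : ℕ) : v.h (n + 1) = 2 * (v.firstLen n + v.lastLen n) := by
  simp only [h, firstLen, lastLen, H]; ring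

theorem h_pos (n : ℕ) : 0 < v.h n := by
  induction n with
  | zero => simp [h]
  | succ n ih =>
    have : 0 < v.lastLen n := Nat.mul_pos (v.m_pos n) ih
    rw [h_succ]; omega

theorem h_le_H (n : ℕ) : v.h n ≤ v.H n := Nat.le_add_right _ _

theorem H_pos (n : ℕ) : 0 < v.H n := (v.h_pos n).trans_le (v.h_le_H n)

theorem w_pos (n : ℕ) : 0 < v.w n := by
  induction n with
  | zero => simp [w]
  | succ n ih =>
    have := v.k_pos n
    have := v.m_pos n
    simp only [w]; positivity

theorem w_eq (n : ℕ) : v.w n = (v.k n * v.m n : ℕ) * v.w (n + 1) := by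
  have h1 : (v.k n : ℝ) ≠ 0 := by exact_mod_cast (v.k_pos n).ne'
  have h2 : (v.m n : ℝ) ≠ 0 := by exact_mod_cast (v.m_pos n).ne'
  simp only [w]; push_cast; field_simp

theorem w_div_k (n : ℕ) : v.w n / v.k n = v.m n * v.w (n + 1) := by
  have h1 : (v.k n : ℝ) ≠ 0 := by exact_mod_cast (v.k_pos n).ne'
  rw [v.w_eq n]; push_cast; field_simp

theorem left_eq (n s : ℕ) : v.left n s = v.pos n s * v.w n := by
  induction n generalizing s with
  | zero => simp [left, pos]
  | succ n ih =>
    have e : v.h n * v.w n = (v.h n * (v.k n * v.m n) : ℕ) * v.w (n + 1) := by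
      conv_lhs => rw [v.w_eq n]
      push_cast; ring
    simp only [left, pos, barLeft, ← firstLen.eq_1, ← lastLen.eq_1, ih, w_div_k, e]
    conv_lhs => rw [v.w_eq n]
    split_ifs <;> (push_cast; ring)

variable {v}

theorem pos_first {n i j r : ℕ} (hj : j < v.m n) (hi : i < v.k n - 1) (hr : r < v.h n) :
    (j * (v.k n - 1) + i) * v.H n + r < v.firstLen n ∧
    v.pos (n + 1) ((j * (v.k n - 1) + i) * v.H n + r)
      = v.pos n r * (v.k n * v.m n) + i * v.m n + j := by
  have hrH : r < v.H n := hr.trans_le (v.h_le_H n)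
  have hK : j * (v.k n - 1) + i < v.m n * (v.k n - 1) := by nlinarith
  have h1 : (j * (v.k n - 1) + i) * v.H n + r < v.firstLen n := by
    unfold firstLen; nlinarith
  have h2 : ((j * (v.k n - 1) + i) * v.H n + r) / v.H n = j * (v.k n - 1) + i := by
    rw [mul_comm, Nat.mul_add_div (v.H_pos n), Nat.div_eq_of_lt hrH, add_zero]
  have h3 : ((j * (v.k n - 1) + i) * v.H n + r) % v.H n = r := by
    rw [mul_comm, Nat.mul_add_mod, Nat.mod_eq_of_lt hrH]
  have h4 : (j * (v.k n - 1) + i) % (v.k n - 1) = i := by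
    rw [mul_comm, Nat.mul_add_mod, Nat.mod_eq_of_lt hi]
  have h5 : (j * (v.k n - 1) + i) / (v.k n - 1) = j := by
    rw [mul_comm, Nat.mul_add_div (by omega), Nat.div_eq_of_lt hi, add_zero]
  refine ⟨h1, ?_⟩
  rw [pos, if_pos h1, h3, if_pos hr, ← Nat.div_div_eq_div_mul, h2, h4, h5]

theorem pos_spacer {n i j e : ℕ} (hj : j < v.m n) (hi : i < v.k n - 1) (he : e < v.l n) :
    (j * (v.k n - 1) + i) * v.H n + (v.h n + e) < v.firstLen n ∧
    v.pos (n + 1) ((j * (v.k n - 1) + i) * v.H n + (v.h n + e))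
      = v.h n * (v.k n * v.m n) + (i * v.l n + e) * v.m n + j := by
  have hrH : v.h n + e < v.H n := by unfold H; omega
  have hK : j * (v.k n - 1) + i < v.m n * (v.k n - 1) := by nlinarith
  have h1 : (j * (v.k n - 1) + i) * v.H n + (v.h n + e) < v.firstLen n := by
    unfold firstLen; nlinarith
  have h2 : ((j * (v.k n - 1) + i) * v.H n + (v.h n + e)) / v.H n = j * (v.k n - 1) + i := by
    rw [mul_comm, Nat.mul_add_div (v.H_pos n), Nat.div_eq_of_lt hrH, add_zero]
  have h3 : ((j * (v.k n - 1) + i) * v.H n + (v.h n + e)) % v.H n = v.h n + e := by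
    rw [mul_comm, Nat.mul_add_mod, Nat.mod_eq_of_lt hrH]
  have h4 : (j * (v.k n - 1) + i) % (v.k n - 1) = i := by
    rw [mul_comm, Nat.mul_add_mod, Nat.mod_eq_of_lt hi]
  have h5 : (j * (v.k n - 1) + i) / (v.k n - 1) = j := by
    rw [mul_comm, Nat.mul_add_div (by omega), Nat.div_eq_of_lt hi, add_zero]
  refine ⟨h1, ?_⟩
  rw [pos, if_pos h1, h3, if_neg (by omega), ← Nat.div_div_eq_div_mul, h2, h4, h5,
    Nat.add_sub_cancel_left]

theorem pos_last {n j r : ℕ} (hj : j < v.m n) (hr : r < v.h n) :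
    v.firstLen n + (j * v.h n + r) < v.firstLen n + v.lastLen n ∧
    v.pos (n + 1) (v.firstLen n + (j * v.h n + r))
      = v.pos n r * (v.k n * v.m n) + (v.k n - 1) * v.m n + j := by
  have h1 : v.firstLen n + (j * v.h n + r) < v.firstLen n + v.lastLen n := by
    unfold lastLen; nlinarith
  refine ⟨h1, ?_⟩
  rw [pos, if_neg (by omega), if_pos h1, Nat.add_sub_cancel_left, mul_comm j,
    Nat.mul_add_mod, Nat.mod_eq_of_lt hr, Nat.mul_add_div (v.h_pos n), Nat.div_eq_of_lt hr,
    add_zero]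

theorem pos_top (n u : ℕ) :
    v.pos (n + 1) (v.firstLen n + v.lastLen n + u)
      = v.h n * (v.k n * v.m n) + (v.k n - 1) * v.l n * v.m n + u := by
  rw [pos, if_neg (by omega), if_neg (by omega), Nat.add_sub_cancel_left]

/-- The number of intervals of length `w_{n+1}` used before the last spacers of `C_{n+1}`. -/
theorem used_eq (n : ℕ) : v.h n * (v.k n * v.m n) + (v.k n - 1) * v.l n * v.m n
    = v.firstLen n + v.lastLen n := by
  obtain ⟨c, hc⟩ : ∃ c, v.k n = c + 1 := ⟨v.k n - 1, by have := v.k_pos n; omega⟩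
  simp only [firstLen, lastLen, H, hc, Nat.add_sub_cancel]; ring

theorem exists_pos_eq (n : ℕ) {p : ℕ} (hp : p < v.h n) : ∃ s < v.h n, v.pos n s = p := by
  induction n generalizing p with
  | zero => exact ⟨0, by simp [h], by simp [h] at hp; simp [pos, hp]⟩
  | succ n ih =>
    have hm := v.m_pos n
    have hk := v.k_pos n
    have hs := v.h_succ n
    have hu := v.used_eq n
    rcases lt_or_ge p (v.h n * (v.k n * v.m n)) with h1 | h1
    · obtain ⟨r, hr, hrp⟩ := ih (Nat.div_lt_of_lt_mul (by rwa [mul_comm] at h1))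
      have e1 := Nat.div_add_mod p (v.k n * v.m n)
      have e2 := Nat.div_add_mod (p % (v.k n * v.m n)) (v.m n)
      have l1 : p % (v.k n * v.m n) < v.k n * v.m n := Nat.mod_lt _ (by positivity)
      have l2 : p % (v.k n * v.m n) / v.m n < v.k n :=
        Nat.div_lt_of_lt_mul (l1.trans_eq (mul_comm _ _))
      have l3 : p % (v.k n * v.m n) % v.m n < v.m n := Nat.mod_lt _ hm
      generalize p % (v.k n * v.m n) / v.m n = i at *
      generalize p % (v.k n * v.m n) % v.m n = j at *
      rcases lt_or_ge i (v.k n - 1) with h2 | h2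
      · obtain ⟨a, b⟩ := pos_first l3 h2 hr
        refine ⟨_, by omega, b.trans ?_⟩
        rw [hrp, mul_comm i, add_assoc, e2, mul_comm, e1]
      · obtain ⟨a, b⟩ := pos_last l3 hr
        refine ⟨_, by omega, b.trans ?_⟩
        rw [hrp, show v.k n - 1 = i by omega, mul_comm i, add_assoc, e2, mul_comm, e1]
    · obtain ⟨u, rfl⟩ := Nat.exists_eq_add_of_le h1
      rcases lt_or_ge u ((v.k n - 1) * v.l n * v.m n) with h2 | h2
      · have e1 := Nat.div_add_mod u (v.m n)
        have e2 := Nat.div_add_mod (u / v.m n) (v.l n)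
        have l1 : u / v.m n < (v.k n - 1) * v.l n :=
          Nat.div_lt_of_lt_mul (by rwa [mul_comm] at h2)
        have l0 : 0 < v.l n := Nat.pos_of_ne_zero fun h0 => by simp [h0] at l1
        have l2 : u / v.m n / v.l n < v.k n - 1 :=
          Nat.div_lt_of_lt_mul (by rwa [mul_comm] at l1)
        obtain ⟨a, b⟩ := pos_spacer (Nat.mod_lt u hm) l2 (Nat.mod_lt (u / v.m n) l0)
        refine ⟨_, by omega, b.trans ?_⟩
        rw [mul_comm _ (v.l n), e2, mul_comm (u / v.m n), add_assoc, e1]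
      · obtain ⟨y, rfl⟩ := Nat.exists_eq_add_of_le h2
        exact ⟨v.firstLen n + v.lastLen n + y, by omega, by rw [pos_top, add_assoc]⟩

theorem image_pos (n : ℕ) : (Finset.range (v.h n)).image (v.pos n) = Finset.range (v.h n) := by
  symm
  apply Finset.eq_of_subset_of_card_le
  · intro p hp
    obtain ⟨s, hs, rfl⟩ := exists_pos_eq n (Finset.mem_range.1 hp)
    exact Finset.mem_image_of_mem _ (Finset.mem_range.2 hs)
  · exact Finset.card_image_le

theorem pos_lt {n s : ℕ} (hs : s < v.h n) : v.pos n s < v.h n := by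
  rw [← Finset.mem_range, ← image_pos]
  exact Finset.mem_image_of_mem _ (Finset.mem_range.2 hs)

theorem pos_inj {n s t : ℕ} (hs : s < v.h n) (ht : t < v.h n) (e : v.pos n s = v.pos n t) :
    s = t := by
  have : Set.InjOn (v.pos n) (Finset.range (v.h n)) :=
    Finset.injOn_of_card_image_eq (by rw [image_pos])
  exact this (by simpa using hs) (by simpa using ht) e

/-! ### Levels and columns -/

theorem mem_level {n s : ℕ} {x : ℝ} :
    x ∈ v.level n s ↔ v.pos n s * v.w n ≤ x ∧ x < (v.pos n s + 1) * v.w n := by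
  rw [level, left_eq, Set.mem_Ico, add_mul, one_mul]

theorem measurableSet_level (n s : ℕ) : MeasurableSet (v.level n s) := measurableSet_Ico

theorem level_disjoint {n s t : ℕ} {x : ℝ} (hs : s < v.h n) (ht : t < v.h n)
    (hx : x ∈ v.level n s) (hy : x ∈ v.level n t) : s = t := by
  rw [mem_level] at hx hy
  have hw := v.w_pos n
  have h1 := lt_of_mul_lt_mul_right (hx.1.trans_lt hy.2) hw.le
  have h2 := lt_of_mul_lt_mul_right (hy.1.trans_lt hx.2) hw.le
  norm_cast at h1 h2
  exact pos_inj hs ht (by omega)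

theorem exists_mem_level {n : ℕ} {x : ℝ} (h0 : 0 ≤ x) (hx : x < v.h n * v.w n) :
    ∃ s < v.h n, x ∈ v.level n s := by
  have hw := v.w_pos n
  have h1 : ⌊x / v.w n⌋₊ < v.h n := by
    rw [Nat.floor_lt (by positivity), div_lt_iff₀ hw]; exact hx
  obtain ⟨s, hs, e⟩ := exists_pos_eq n h1
  refine ⟨s, hs, mem_level.2 ?_⟩
  rw [e, ← le_div_iff₀ hw, ← div_lt_iff₀ hw]
  exact ⟨Nat.floor_le (by positivity), Nat.lt_floor_add_one _⟩

theorem level_bounds {n s : ℕ} {x : ℝ} (hs : s < v.h n) (hx : x ∈ v.level n s) :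
    0 ≤ x ∧ x < v.h n * v.w n := by
  have hw := v.w_pos n
  rw [mem_level] at hx
  have h1 : (v.pos n s : ℝ) + 1 ≤ v.h n := by exact_mod_cast pos_lt hs
  exact ⟨le_trans (by positivity) hx.1, hx.2.trans_le (by gcongr)⟩

theorem column_eq (n : ℕ) : v.column n = Set.Ico 0 (v.h n * v.w n) := by
  ext x
  simp only [column, Set.mem_iUnion, Finset.mem_range, Set.mem_Ico, exists_prop]
  exact ⟨fun ⟨s, hs, hx⟩ => level_bounds hs hx, fun hx => exists_mem_level hx.1 hx.2⟩

theorem used_le (n : ℕ) : v.h n * v.w n ≤ (v.firstLen n + v.lastLen n : ℕ) * v.w (n + 1) := by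
  have hw := v.w_pos (n + 1)
  rw [v.w_eq n, ← mul_assoc]
  gcongr
  exact_mod_cast (Nat.le_add_right _ _).trans (used_eq n).le

theorem column_bound_le (n : ℕ) : v.h n * v.w n ≤ v.h (n + 1) * v.w (n + 1) := by
  refine (used_le n).trans ?_
  have hw := v.w_pos (n + 1)
  have := v.h_succ n
  gcongr
  omega

theorem column_mono : Monotone v.column := by
  refine monotone_nat_of_le_succ fun n => ?_
  rw [column_eq, column_eq]
  exact Set.Ico_subset_Ico_right (column_bound_le n)

theorem level_subset_column {n s : ℕ} (hs : s < v.h n) : v.level n s ⊆ v.column n := by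
  intro x hx
  rw [column_eq]; exact level_bounds hs hx

theorem column_subset_X (n : ℕ) : v.column n ⊆ v.X := Set.subset_iUnion _ n

/-- Level `t` of `C_{n+1}` is a piece of level `r` of `C_n`. -/
def IsPiece (v : CutStack) (n t r : ℕ) : Prop :=
  r < v.h n ∧ (t < v.firstLen n ∧ t % v.H n = r ∨
    v.firstLen n ≤ t ∧ t < v.firstLen n + v.lastLen n ∧ (t - v.firstLen n) % v.h n = r)

theorem IsPiece.lt {n t r : ℕ} (ht : v.IsPiece n t r) : t < v.firstLen n + v.lastLen n := by
  obtain ⟨-, ⟨h, -⟩ | ⟨-, h, -⟩⟩ := ht <;> omega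

theorem div_lt_of_lt_firstLen {n t : ℕ} (ht : t < v.firstLen n) :
    t / v.H n % (v.k n - 1) < v.k n - 1 ∧ t / (v.H n * (v.k n - 1)) < v.m n := by
  have h1 : 0 < v.k n - 1 := Nat.pos_of_ne_zero fun h0 => by simp [firstLen, h0] at ht
  refine ⟨Nat.mod_lt _ h1, Nat.div_lt_of_lt_mul (ht.trans_le (le_of_eq ?_))⟩
  unfold firstLen; ring

theorem level_subset_of_pos {n t r : ℕ} {a : ℕ} (ha : a < v.k n * v.m n)
    (e : v.pos (n + 1) t = v.pos n r * (v.k n * v.m n) + a) :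
    v.level (n + 1) t ⊆ v.level n r := by
  intro x hx
  rw [mem_level] at hx ⊢
  have hw := v.w_pos (n + 1)
  rw [v.w_eq n, ← mul_assoc, ← mul_assoc]
  rw [e] at hx
  constructor
  · refine le_trans ?_ hx.1
    gcongr
    exact_mod_cast Nat.le_add_right _ _
  · refine hx.2.trans_le ?_
    gcongr
    norm_cast
    rw [add_mul, one_mul]; omega

theorem IsPiece.subset {n t r : ℕ} (ht : v.IsPiece n t r) :
    v.level (n + 1) t ⊆ v.level n r := by
  have hk := v.k_pos n
  obtain ⟨hr, ⟨h1, h2⟩ | ⟨h1, h2, h3⟩⟩ := ht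
  · obtain ⟨hi, hj⟩ := div_lt_of_lt_firstLen h1
    refine level_subset_of_pos
      (a := t / v.H n % (v.k n - 1) * v.m n + t / (v.H n * (v.k n - 1))) ?_ ?_
    · have : t / v.H n % (v.k n - 1) + 1 ≤ v.k n := by omega
      nlinarith
    · rw [pos, if_pos h1, h2, if_pos hr, add_assoc]
  · refine level_subset_of_pos
      (a := (v.k n - 1) * v.m n + (t - v.firstLen n) / v.h n) ?_ ?_
    · have h4 : (t - v.firstLen n) / v.h n < v.m n := by
        refine Nat.div_lt_of_lt_mul ?_
        rw [mul_comm, ← lastLen.eq_1]; omega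
      obtain ⟨c, hc⟩ : ∃ c, v.k n = c + 1 := ⟨v.k n - 1, by omega⟩
      rw [hc, Nat.add_sub_cancel, add_mul]; omega
    · rw [pos, if_neg (by omega), if_pos h2, h3, add_assoc]

/-- A point of `C_n` lies in some level of `C_{n+1}` that is a piece of its level in `C_n`. -/
theorem exists_isPiece {n r : ℕ} (hr : r < v.h n) {x : ℝ} (hx : x ∈ v.level n r) :
    ∃ t, v.IsPiece n t r ∧ x ∈ v.level (n + 1) t := by
  obtain ⟨h0, h1⟩ := level_bounds hr hx
  obtain ⟨t, ht, hxt⟩ := exists_mem_level h0 (h1.trans_le (column_bound_le n))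
  have hw := v.w_pos (n + 1)
  have out : ∀ a, v.pos (n + 1) t = v.h n * (v.k n * v.m n) + a → False := by
    intro a ha
    rw [mem_level, ha] at hxt
    rw [v.w_eq n, ← mul_assoc] at h1
    have := lt_of_mul_lt_mul_right (hxt.1.trans_lt h1) hw.le
    norm_cast at this
    omega
  have piece : ∀ r', v.IsPiece n t r' → v.IsPiece n t r := fun r' hp => by
    rwa [level_disjoint hr hp.1 hx (hp.subset hxt)]
  refine ⟨t, ?_, hxt⟩
  rcases lt_or_ge t (v.firstLen n) with h2 | h2
  · by_cases h3 : t % v.H n < v.h n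
    · exact piece _ ⟨h3, Or.inl ⟨h2, rfl⟩⟩
    · exact (out _ (by rw [pos, if_pos h2, if_neg h3, add_assoc])).elim
  · by_cases h3 : t < v.firstLen n + v.lastLen n
    · exact piece _ ⟨Nat.mod_lt _ (v.h_pos n), Or.inr ⟨h2, h3, rfl⟩⟩
    · exact (out _ (by rw [pos, if_neg (by omega), if_neg h3, add_assoc])).elim

theorem mod_succ_of_lt {a t : ℕ} (ha : t % a + 1 < a) :
    (t + 1) % a = t % a + 1 ∧ (t + 1) / a = t / a := by
  have e := Nat.div_add_mod t a
  constructor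
  · conv_lhs => rw [← e, add_assoc, Nat.mul_add_mod, Nat.mod_eq_of_lt ha]
  · conv_lhs => rw [← e, add_assoc, Nat.mul_add_div (by omega), Nat.div_eq_of_lt ha, add_zero]

/-- The translations between consecutive levels of `C_n` and of `C_{n+1}` agree. -/
theorem IsPiece.succ {n t r : ℕ} (ht : v.IsPiece n t r) (hr : r + 1 < v.h n) :
    v.IsPiece n (t + 1) (r + 1) ∧
      v.left (n + 1) (t + 1) - v.left (n + 1) t = v.left n (r + 1) - v.left n r := by
  have hH := v.h_le_H n
  suffices v.IsPiece n (t + 1) (r + 1) ∧ ∃ a, v.pos (n + 1) t = v.pos n r * (v.k n * v.m n) + a ∧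
      v.pos (n + 1) (t + 1) = v.pos n (r + 1) * (v.k n * v.m n) + a by
    obtain ⟨h1, a, h2, h3⟩ := this
    refine ⟨h1, ?_⟩
    rw [left_eq, left_eq, left_eq, left_eq, h2, h3, v.w_eq n]
    push_cast; ring
  obtain ⟨hr', ⟨h1, h2⟩ | ⟨h1, h2, h3⟩⟩ := ht
  · obtain ⟨e1, e2⟩ := mod_succ_of_lt (a := v.H n) (t := t) (by omega)
    have h3 : t + 1 < v.firstLen n := by
      have e := Nat.div_add_mod (t + 1) (v.H n)
      have : t / v.H n < v.m n * (v.k n - 1) :=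
        Nat.div_lt_of_lt_mul (by rwa [firstLen, mul_comm] at h1)
      rw [e1, e2] at e
      unfold firstLen
      nlinarith
    refine ⟨⟨hr, Or.inl ⟨h3, by omega⟩⟩,
      t / v.H n % (v.k n - 1) * v.m n + t / (v.H n * (v.k n - 1)), ?_, ?_⟩
    · rw [pos, if_pos h1, h2, if_pos hr', add_assoc]
    · rw [pos, if_pos h3, e1, h2, if_pos hr, ← Nat.div_div_eq_div_mul, e2,
        Nat.div_div_eq_div_mul, add_assoc]
  · obtain ⟨e1, e2⟩ := mod_succ_of_lt (a := v.h n) (t := t - v.firstLen n) (by omega)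
    rw [← Nat.sub_add_comm h1] at e1 e2
    have h4 : t + 1 < v.firstLen n + v.lastLen n := by
      have e := Nat.div_add_mod (t + 1 - v.firstLen n) (v.h n)
      have : (t - v.firstLen n) / v.h n < v.m n :=
        Nat.div_lt_of_lt_mul (by rw [mul_comm, ← lastLen.eq_1]; omega)
      rw [e1, e2, h3] at e
      have : t + 1 - v.firstLen n < v.lastLen n := by
        unfold lastLen
        nlinarith
      omega
    refine ⟨⟨hr, Or.inr ⟨by omega, h4, by omega⟩⟩,
      (v.k n - 1) * v.m n + (t - v.firstLen n) / v.h n, ?_, ?_⟩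
    · rw [pos, if_neg (by omega), if_pos h2, h3, add_assoc]
    · rw [pos, if_neg (by omega), if_pos h4, e1, h3, e2, add_assoc]

end CutStack

namespace CutStack

variable {v : CutStack}

/-! ### The transformation -/

theorem exists_level_of_le {n s : ℕ} (hs : s + 1 < v.h n) {x : ℝ} (hx : x ∈ v.level n s) {N : ℕ}
    (hN : n ≤ N) : ∃ t, t + 1 < v.h N ∧ x ∈ v.level N t ∧
      v.left N (t + 1) - v.left N t = v.left n (s + 1) - v.left n s := by
  induction N, hN using Nat.le_induction with
  | base => exact ⟨s, hs, hx, rfl⟩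
  | succ N _ ih =>
    obtain ⟨t, ht, hxt, e⟩ := ih
    obtain ⟨t', hp, hxt'⟩ := exists_isPiece (by omega) hxt
    obtain ⟨hp', e'⟩ := hp.succ ht
    have := hp'.lt
    have := v.h_succ N
    exact ⟨t', by omega, hxt', e'.trans e⟩

theorem T_apply {n s : ℕ} (hs : s + 1 < v.h n) {x : ℝ} (hx : x ∈ v.level n s) :
    v.T x = x + (v.left n (s + 1) - v.left n s) := by
  have hex : ∃ p : ℕ × ℕ, p.2 + 1 < v.h p.1 ∧ x ∈ v.level p.1 p.2 := ⟨(n, s), hs, hx⟩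
  obtain ⟨h1, h2⟩ := hex.choose_spec
  rw [T, dif_pos hex]
  generalize hex.choose = p at *
  obtain ⟨a, ha, hxa, ea⟩ := exists_level_of_le h1 h2 (le_max_left p.1 n)
  obtain ⟨b, hb, hxb, eb⟩ := exists_level_of_le hs hx (le_max_right p.1 n)
  have hab : a = b := level_disjoint (by omega) (by omega) hxa hxb
  rw [← ea, ← eb, hab]

theorem add_mem_level_iff {n s t : ℕ} {x : ℝ} :
    x + (v.left n t - v.left n s) ∈ v.level n t ↔ x ∈ v.level n s := by
  simp only [level, Set.mem_Ico]
  constructor <;> rintro ⟨h1, h2⟩ <;> constructor <;> linarith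

theorem iterate_T_apply {n s i : ℕ} (hs : s + i < v.h n) {x : ℝ} (hx : x ∈ v.level n s) :
    v.T^[i] x = x + (v.left n (s + i) - v.left n s) := by
  induction i with
  | zero => simp
  | succ i ih =>
    have e := ih (by omega)
    have hm : v.T^[i] x ∈ v.level n (s + i) := by rw [e]; exact add_mem_level_iff.2 hx
    rw [Function.iterate_succ_apply', T_apply (by omega) hm, e, add_assoc s]
    ring

theorem iterate_T_mem {n s i : ℕ} (hs : s + i < v.h n) {x : ℝ} (hx : x ∈ v.level n s) :
    v.T^[i] x ∈ v.level n (s + i) := by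
  rw [iterate_T_apply hs hx]; exact add_mem_level_iff.2 hx

theorem volume_level (n s : ℕ) : volume (v.level n s) = ENNReal.ofReal (v.w n) := by
  simp [level]

theorem volume_iterate_preimage_inter_level {n s i : ℕ} (hs : s + i < v.h n) (A : Set ℝ) :
    volume (v.T^[i] ⁻¹' A ∩ v.level n s) = volume (A ∩ v.level n (s + i)) := by
  rw [← measure_preimage_add_right volume (v.left n (s + i) - v.left n s) (A ∩ v.level n (s + i))]
  congr 1
  ext x
  simp only [Set.mem_inter_iff, Set.mem_preimage, add_mem_level_iff]
  refine and_congr_left fun hx => ?_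
  rw [iterate_T_apply hs hx]

theorem measurable_T : Measurable v.T := by
  intro A hA
  have e : v.T ⁻¹' A = (⋃ p ∈ {p : ℕ × ℕ | p.2 + 1 < v.h p.1},
        v.level p.1 p.2 ∩ (· + (v.left p.1 (p.2 + 1) - v.left p.1 p.2)) ⁻¹' A) ∪
      (A \ ⋃ p ∈ {p : ℕ × ℕ | p.2 + 1 < v.h p.1}, v.level p.1 p.2) := by
    ext x
    simp only [Set.mem_preimage, Set.mem_union, Set.mem_iUnion, Set.mem_inter_iff, Set.mem_sdiff,
      Set.mem_ofPred_eq, exists_prop]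
    by_cases hx : ∃ p : ℕ × ℕ, p.2 + 1 < v.h p.1 ∧ x ∈ v.level p.1 p.2
    · obtain ⟨p, h1, h2⟩ := hx
      rw [T_apply h1 h2]
      constructor
      · exact fun h => Or.inl ⟨p, h1, h2, h⟩
      · rintro (⟨q, h3, h4, h5⟩ | ⟨-, h3⟩)
        · rwa [← T_apply h3 h4, T_apply h1 h2] at h5
        · exact (h3 ⟨p, h1, h2⟩).elim
    · rw [T, dif_neg hx]
      constructor
      · exact fun h => Or.inr ⟨h, hx⟩
      · rintro (⟨q, h3, h4, -⟩ | ⟨h3, -⟩)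
        · exact (hx ⟨q, h3, h4⟩).elim
        · exact h3
  rw [e]
  refine .union (.biUnion (Set.to_countable _) fun p _ => (measurableSet_level _ _).inter
    (measurable_add_const _ hA)) (hA.diff (.biUnion (Set.to_countable _)
    fun p _ => measurableSet_level _ _))

/-! ### Unions of levels -/

/-- The union of the levels of `C_n` with numbers in `S`. -/
def levels (v : CutStack) (n : ℕ) (S : Finset ℕ) : Set ℝ := ⋃ s ∈ S, v.level n s

theorem measurableSet_levels (n : ℕ) (S : Finset ℕ) : MeasurableSet (v.levels n S) :=
  S.measurableSet_biUnion fun _ _ => measurableSet_level _ _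

theorem mem_levels {n : ℕ} {S : Finset ℕ} {x : ℝ} :
    x ∈ v.levels n S ↔ ∃ s ∈ S, x ∈ v.level n s := by simp [levels]

theorem mem_levels_iff {n : ℕ} {S : Finset ℕ} (hS : S ⊆ Finset.range (v.h n)) {s : ℕ}
    (hs : s < v.h n) {x : ℝ} (hx : x ∈ v.level n s) : x ∈ v.levels n S ↔ s ∈ S := by
  rw [mem_levels]
  refine ⟨fun ⟨t, ht, hxt⟩ => ?_, fun h => ⟨s, h, hx⟩⟩
  rwa [level_disjoint hs (Finset.mem_range.1 (hS ht)) hx hxt]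

theorem levels_subset_column {n : ℕ} {S : Finset ℕ} (hS : S ⊆ Finset.range (v.h n)) :
    v.levels n S ⊆ v.column n :=
  Set.iUnion₂_subset fun _ hs => level_subset_column (Finset.mem_range.1 (hS hs))

theorem pairwiseDisjoint_level {n : ℕ} {S : Finset ℕ} (hS : S ⊆ Finset.range (v.h n)) :
    (S : Set ℕ).PairwiseDisjoint (v.level n) := by
  intro s hs t ht hst
  rw [Function.onFun, Set.disjoint_left]
  exact fun x hx hy => hst (level_disjoint (Finset.mem_range.1 (hS hs))
    (Finset.mem_range.1 (hS ht)) hx hy)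

theorem setLIntegral_levels {n : ℕ} {S : Finset ℕ} (hS : S ⊆ Finset.range (v.h n))
    (f : ℝ → ℝ≥0∞) :
    ∫⁻ x in v.levels n S, f x = ∑ s ∈ S, ∫⁻ x in v.level n s, f x :=
  lintegral_biUnion_finset (pairwiseDisjoint_level hS) (fun _ _ => measurableSet_level _ _) f

theorem volume_inter_levels {n : ℕ} {S : Finset ℕ} (hS : S ⊆ Finset.range (v.h n))
    (A : Set ℝ) :
    volume (A ∩ v.levels n S) = ∑ s ∈ S, volume (A ∩ v.level n s) := by
  have h2 := lintegral_biUnion_finset (μ := volume.restrict A) (pairwiseDisjoint_level hS)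
    (fun _ _ => measurableSet_level _ _) (fun _ => 1)
  simp only [setLIntegral_one, Measure.restrict_apply (measurableSet_level _ _)] at h2
  rw [← levels.eq_1, Measure.restrict_apply (measurableSet_levels n S)] at h2
  simpa only [Set.inter_comm A] using h2

theorem volume_levels {n : ℕ} {S : Finset ℕ} (hS : S ⊆ Finset.range (v.h n)) :
    volume (v.levels n S) = S.card * ENNReal.ofReal (v.w n) := by
  have := volume_inter_levels hS Set.univ
  simpa [volume_level] using this

theorem levels_range (n : ℕ) : v.levels n (Finset.range (v.h n)) = v.column n := rfl

/-! ### Invariance of the measure -/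

theorem measurableSet_X : MeasurableSet v.X :=
  .iUnion fun n => by rw [← levels_range]; exact measurableSet_levels _ _

theorem μ_apply (A : Set ℝ) : v.μ A = volume (A ∩ v.X) :=
  Measure.restrict_apply' measurableSet_X

theorem μ_apply_of_subset {n : ℕ} {A : Set ℝ} (hA : A ⊆ v.column n) : v.μ A = volume A := by
  rw [μ_apply, Set.inter_eq_self_of_subset_left (hA.trans (column_subset_X n))]

theorem μ_restrict {n : ℕ} {A : Set ℝ} (hAm : MeasurableSet A) (hA : A ⊆ v.column n) :
    v.μ.restrict A = volume.restrict A := by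
  rw [μ, Measure.restrict_restrict hAm,
    Set.inter_eq_self_of_subset_left (hA.trans (column_subset_X n))]

theorem column_subset_levels_succ (n : ℕ) :
    v.column n ⊆ v.levels (n + 1) (Finset.range (v.h (n + 1) - 1)) := by
  intro x hx
  rw [← levels_range, mem_levels] at hx
  obtain ⟨r, hr, hx⟩ := hx
  obtain ⟨t, hp, hxt⟩ := exists_isPiece (Finset.mem_range.1 hr) hx
  have := hp.lt
  have := v.h_succ n
  exact mem_levels.2 ⟨t, Finset.mem_range.2 (by omega), hxt⟩

theorem volume_inter_column (n : ℕ) (A : Set ℝ) :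
    volume (A ∩ v.column n) = volume (v.T ⁻¹' A ∩ v.levels n (Finset.range (v.h n - 1)))
      + volume (A ∩ v.level n 0) := by
  have h0 := v.h_pos n
  rw [← levels_range, volume_inter_levels subset_rfl,
    volume_inter_levels (Finset.range_mono (Nat.sub_le _ _))]
  conv_lhs => rw [show v.h n = v.h n - 1 + 1 by omega, Finset.sum_range_succ']
  congr 1
  refine Finset.sum_congr rfl fun s hs => ?_
  have := Finset.mem_range.1 hs
  exact (volume_iterate_preimage_inter_level (i := 1) (by omega) A).symm

/-- The base of `C_n` is the only part of `C_n` that is not in the image of `C_n` without its top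
level, so `T` preserves the measure as soon as the widths tend to zero. -/
theorem measurePreserving_T (hw : Tendsto v.w atTop (𝓝 0)) : MeasurePreserving v.T v.μ v.μ := by
  refine ⟨measurable_T, Measure.ext fun A hA => ?_⟩
  rw [Measure.map_apply measurable_T hA, μ_apply, μ_apply]
  have lim : ∀ B : Set ℝ, Tendsto (fun n => volume (B ∩ v.column n)) atTop
      (𝓝 (volume (B ∩ v.X))) := by
    intro B
    rw [X, Set.inter_iUnion]
    exact tendsto_measure_iUnion_atTop fun a b hab =>
      Set.inter_subset_inter_right _ (column_mono hab)
  apply le_antisymm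
  · refine le_of_tendsto' (lim _) fun n => ?_
    calc volume (v.T ⁻¹' A ∩ v.column n)
        ≤ volume (v.T ⁻¹' A ∩ v.levels (n + 1) (Finset.range (v.h (n + 1) - 1))) := by
          gcongr; exact column_subset_levels_succ n
      _ ≤ volume (A ∩ v.column (n + 1)) := by rw [volume_inter_column]; exact le_self_add
      _ ≤ _ := by gcongr; exact column_subset_X _
  · have h2 : Tendsto (fun n => volume (v.T ⁻¹' A ∩ v.X) + ENNReal.ofReal (v.w n)) atTop
        (𝓝 (volume (v.T ⁻¹' A ∩ v.X))) := by
      have := (tendsto_const_nhds (x := volume (v.T ⁻¹' A ∩ v.X))).add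
        (ENNReal.tendsto_ofReal hw)
      simpa using this
    refine le_of_tendsto_of_tendsto' (lim A) h2 fun n => ?_
    rw [volume_inter_column]
    gcongr
    · exact (levels_subset_column (Finset.range_mono (Nat.sub_le _ _))).trans (column_subset_X n)
    · exact (measure_mono Set.inter_subset_right).trans_eq (volume_level n 0)

end CutStack

/-! ### Pairwise independent sets with divergent sum of probabilities -/

/-- If the sets `Z n` are pairwise independent and the sum of their probabilities `p n` diverges,
then infinitely many of them meet a given set `F` of positive measure in at least half the expected
proportion. Indeed, the centred indicator functions of the `Z n` are orthogonal, so the inner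
products of the indicator function of `F` with them are controlled by Bessel's inequality. -/
theorem frequently_measureReal_inter_ge {Ω : Type*} [MeasurableSpace Ω] {ν : Measure Ω}
    [IsFiniteMeasure ν] {Z : ℕ → Set Ω} (hZ : ∀ n, MeasurableSet (Z n)) {p : ℕ → ℝ}
    (hps : Tendsto (fun n => ∑ i ∈ Finset.range n, p i) atTop atTop) {N : ℕ}
    (h1 : ∀ n, N ≤ n → ν.real (Z n) = p n * ν.real Set.univ)
    (h2 : ∀ n m, N ≤ n → n < m → ν.real (Z n ∩ Z m) = p n * p m * ν.real Set.univ)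
    {F : Set Ω} (hF : MeasurableSet F) (hF0 : 0 < ν.real F) :
    ∃ᶠ n in atTop, p n * ν.real F / 2 ≤ ν.real (F ∩ Z n) := by
  intro hcon
  simp only [not_le] at hcon
  obtain ⟨N0, hN0⟩ := eventually_atTop.1 hcon
  set M := max N0 N
  set V := ν.real Set.univ
  set c := ν.real F
  have hV : 0 < V := hF0.trans_le (measureReal_mono (Set.subset_univ _))
  have ind : ∀ A : Set Ω, MeasurableSet A → Integrable (A.indicator (1 : Ω → ℝ)) ν :=
    fun A hA => (integrable_const (1 : ℝ)).indicator hA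
  let f : ℕ → Ω → ℝ := fun n x => (Z n).indicator 1 x - p n
  have hff : ∀ n m x, f n x * f m x = (Z n ∩ Z m).indicator (1 : Ω → ℝ) x
      - p m * (Z n).indicator (1 : Ω → ℝ) x - p n * (Z m).indicator (1 : Ω → ℝ) x
      + p n * p m := by
    intro n m x
    by_cases a : x ∈ Z n <;> by_cases b : x ∈ Z m <;> simp [f, a, b] <;> ring
  have hffi : ∀ n m, Integrable (fun x => f n x * f m x) ν := by
    intro n m
    simp only [hff]
    exact (((ind _ ((hZ n).inter (hZ m))).sub ((ind _ (hZ n)).const_mul _)).sub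
      ((ind _ (hZ m)).const_mul _)).add (integrable_const _)
  have hffv : ∀ n m, ∫ x, f n x * f m x ∂ν = ν.real (Z n ∩ Z m) - p m * ν.real (Z n)
      - p n * ν.real (Z m) + p n * p m * V := by
    intro n m
    have i1 := ind _ ((hZ n).inter (hZ m))
    have i2 := (ind _ (hZ n)).const_mul (p m)
    have i3 := (ind _ (hZ m)).const_mul (p n)
    have i4 : Integrable (fun x => (Z n ∩ Z m).indicator (1 : Ω → ℝ) x
        - p m * (Z n).indicator (1 : Ω → ℝ) x) ν := i1.sub i2
    have i5 : Integrable (fun x => (Z n ∩ Z m).indicator (1 : Ω → ℝ) x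
        - p m * (Z n).indicator (1 : Ω → ℝ) x - p n * (Z m).indicator (1 : Ω → ℝ) x) ν :=
      i4.sub i3
    simp only [hff]
    rw [integral_add i5 (integrable_const _), integral_sub i4 i3,
      integral_sub i1 i2, integral_const_mul, integral_const_mul,
      integral_indicator_one ((hZ n).inter (hZ m)), integral_indicator_one (hZ n),
      integral_indicator_one (hZ m)]
    simp [V]; ring
  have hgf : ∀ n x, F.indicator (1 : Ω → ℝ) x * f n x
      = (F ∩ Z n).indicator (1 : Ω → ℝ) x - p n * F.indicator (1 : Ω → ℝ) x := by
    intro n x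
    by_cases a : x ∈ Z n <;> by_cases b : x ∈ F <;> simp [f, a, b]
  have hgfi : ∀ n, Integrable (fun x => F.indicator (1 : Ω → ℝ) x * f n x) ν := by
    intro n
    simp only [hgf]
    exact (ind _ (hF.inter (hZ n))).sub ((ind _ hF).const_mul _)
  have hgfv : ∀ n, ∫ x, F.indicator (1 : Ω → ℝ) x * f n x ∂ν = ν.real (F ∩ Z n) - p n * c := by
    intro n
    simp only [hgf]
    rw [integral_sub (ind _ (hF.inter (hZ n))) ((ind _ hF).const_mul _), integral_const_mul,
      integral_indicator_one (hF.inter (hZ n)), integral_indicator_one hF]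
  have bound : ∀ L, ∑ n ∈ Finset.Ico M L, p n ≤ 4 * V / c := by
    intro L
    set I := Finset.Ico M L
    set P := ∑ n ∈ I, p n
    set τ := c / (2 * V) with hτ
    have hexp : ∀ x, (F.indicator (1 : Ω → ℝ) x + τ * ∑ n ∈ I, f n x) ^ 2
        = F.indicator (1 : Ω → ℝ) x + 2 * τ * ∑ n ∈ I, F.indicator (1 : Ω → ℝ) x * f n x
          + τ ^ 2 * ∑ n ∈ I, ∑ m ∈ I, f n x * f m x := by
      intro x
      rw [← Finset.mul_sum, ← Finset.sum_mul_sum]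
      by_cases b : x ∈ F <;> simp [b] <;> ring
    have hint : ∫ x, (F.indicator (1 : Ω → ℝ) x + τ * ∑ n ∈ I, f n x) ^ 2 ∂ν
        = c + 2 * τ * ∑ n ∈ I, (ν.real (F ∩ Z n) - p n * c)
          + τ ^ 2 * ∑ n ∈ I, ∑ m ∈ I, (ν.real (Z n ∩ Z m) - p m * ν.real (Z n)
      - p n * ν.real (Z m) + p n * p m * V) := by
      have j1 : Integrable (fun x => 2 * τ * ∑ n ∈ I, F.indicator (1 : Ω → ℝ) x * f n x) ν :=
        (integrable_finsetSum _ fun n _ => hgfi n).const_mul _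
      have j2 : Integrable (fun x => τ ^ 2 * ∑ n ∈ I, ∑ m ∈ I, f n x * f m x) ν :=
        (integrable_finsetSum _ fun n _ => integrable_finsetSum _ fun m _ => hffi n m).const_mul _
      have j3 : Integrable (fun x => F.indicator (1 : Ω → ℝ) x
          + 2 * τ * ∑ n ∈ I, F.indicator (1 : Ω → ℝ) x * f n x) ν := (ind F hF).add j1
      simp only [hexp]
      rw [integral_add j3 j2, integral_add (ind F hF) j1, integral_const_mul,
        integral_const_mul, integral_finsetSum _ fun n _ => hgfi n,
        integral_finsetSum _ fun n _ => integrable_finsetSum _ fun m _ => hffi n m,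
        integral_indicator_one hF]
      simp only [hgfv, integral_finsetSum _ fun m _ => hffi _ m, hffv]
      rfl
    have s1 : ∑ n ∈ I, (ν.real (F ∩ Z n) - p n * c) ≤ -(P * c / 2) := by
      have : -(P * c / 2) = ∑ n ∈ I, -(p n * c / 2) := by
        rw [Finset.sum_neg_distrib, ← Finset.sum_div, ← Finset.sum_mul]
      rw [this]
      refine Finset.sum_le_sum fun n hn => ?_
      have := hN0 n ((le_max_left _ _).trans (Finset.mem_Ico.1 hn).1)
      linarith
    have s2 : ∑ n ∈ I, ∑ m ∈ I, (ν.real (Z n ∩ Z m) - p m * ν.real (Z n)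
        - p n * ν.real (Z m) + p n * p m * V) ≤ P * V := by
      rw [Finset.sum_mul]
      refine Finset.sum_le_sum fun n hn => ?_
      have hnN : N ≤ n := (le_max_right _ _).trans (Finset.mem_Ico.1 hn).1
      rw [Finset.sum_eq_single_of_mem n hn]
      · rw [Set.inter_self, h1 n hnN]
        nlinarith [mul_nonneg (mul_self_nonneg (p n)) hV.le]
      · intro m hm hmn
        have hmN : N ≤ m := (le_max_right _ _).trans (Finset.mem_Ico.1 hm).1
        rw [h1 n hnN, h1 m hmN]
        rcases lt_or_gt_of_ne hmn with h | h
        · rw [Set.inter_comm, h2 m n hmN h]; ring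
        · rw [h2 n m hnN h]; ring
    have hτ0 : 0 < τ := by positivity
    have hnn : 0 ≤ ∫ x, (F.indicator (1 : Ω → ℝ) x + τ * ∑ n ∈ I, f n x) ^ 2 ∂ν :=
      integral_nonneg fun x => sq_nonneg _
    have t1 := mul_le_mul_of_nonneg_left s1 (by positivity : 0 ≤ 2 * τ)
    have t2 := mul_le_mul_of_nonneg_left s2 (by positivity : 0 ≤ τ ^ 2)
    have t3 : 0 ≤ c + 2 * τ * -(P * c / 2) + τ ^ 2 * (P * V) := by linarith
    have t4 : c + 2 * τ * -(P * c / 2) + τ ^ 2 * (P * V) = c * (1 - P * c / (4 * V)) := by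
      rw [hτ]; field_simp; ring
    rw [t4] at t3
    have t5 := nonneg_of_mul_nonneg_right t3 hF0
    rw [sub_nonneg, div_le_one (by positivity)] at t5
    rwa [le_div_iff₀ hF0]
  obtain ⟨L, hL, hLM⟩ := ((hps.eventually_gt_atTop
    (4 * V / c + ∑ i ∈ Finset.range M, p i)).and (eventually_ge_atTop M)).exists
  have := bound L
  rw [Finset.sum_Ico_eq_sub _ hLM] at this
  linarith

/-! ### Counting along periodic patterns -/

theorem card_filter_range_of_periodic {p : ℕ → Prop} [DecidablePred p] {a : ℕ}
    (hp : Function.Periodic p a) (q t : ℕ) :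
    ((Finset.range (q * a)).filter fun i => p (t + i)).card
      = q * ((Finset.range a).filter p).card := by
  induction q generalizing t with
  | zero => simp
  | succ q ih =>
    have h0 := Nat.filter_Ico_card_eq_of_periodic t a p hp
    rw [Nat.count_eq_card_filter_range] at h0
    have h1 : ((Finset.range a).filter fun i => p (t + i)).card
        = ((Finset.Ico t (t + a)).filter p).card := by
      refine Finset.card_bij (fun i _ => t + i) (fun i hi => ?_) (fun i _ j _ e => by omega)
        fun y hy => ?_
      · simp only [Finset.mem_filter, Finset.mem_range, Finset.mem_Ico] at hi ⊢
        exact ⟨by omega, hi.2⟩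
      · simp only [Finset.mem_filter, Finset.mem_range, Finset.mem_Ico] at hy ⊢
        have e : t + (y - t) = y := by omega
        exact ⟨y - t, ⟨by omega, by rw [e]; exact hy.2⟩, e⟩
    have h2 := ih (t + a)
    rw [← Nat.count_eq_card_filter_range] at h1 h2 ⊢
    rw [add_mul, one_mul, add_comm (q * a), Nat.count_add, h1, h0]
    simp only [← add_assoc]
    rw [h2]; ring

theorem card_filter_mod_mem {a : ℕ} {S : Finset ℕ} (hS : S ⊆ Finset.range a) (q t : ℕ) :
    ((Finset.range (q * a)).filter fun i => (t + i) % a ∈ S).card = q * S.card := by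
  rw [card_filter_range_of_periodic (p := fun i => i % a ∈ S)
    (fun x => by simp only [Nat.add_mod_right])]
  congr 2
  ext i
  simp only [Finset.mem_filter, Finset.mem_range]
  constructor
  · rintro ⟨h1, h2⟩
    rwa [Nat.mod_eq_of_lt h1] at h2
  · intro h
    have := Finset.mem_range.1 (hS h)
    exact ⟨this, by rwa [Nat.mod_eq_of_lt this]⟩

namespace CutStack

variable {v : CutStack}

/-! ### Refining unions of levels -/

/-- The levels of `C_{n+1}` that are pieces of the levels of `C_n` with numbers in `S`. -/
def pieces (v : CutStack) (n : ℕ) (S : Finset ℕ) : Finset ℕ :=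
  (Finset.range (v.firstLen n + v.lastLen n)).filter fun t =>
    t < v.firstLen n ∧ t % v.H n ∈ S ∨ v.firstLen n ≤ t ∧ (t - v.firstLen n) % v.h n ∈ S

theorem mem_pieces {n : ℕ} {S : Finset ℕ} (hS : S ⊆ Finset.range (v.h n)) {t : ℕ} :
    t ∈ v.pieces n S ↔ ∃ r ∈ S, v.IsPiece n t r := by
  simp only [pieces, IsPiece, Finset.mem_filter, Finset.mem_range]
  constructor
  · rintro ⟨h1, ⟨h2, h3⟩ | ⟨h2, h3⟩⟩
    · exact ⟨_, h3, Finset.mem_range.1 (hS h3), Or.inl ⟨h2, rfl⟩⟩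
    · exact ⟨_, h3, Finset.mem_range.1 (hS h3), Or.inr ⟨h2, h1, rfl⟩⟩
  · rintro ⟨r, hr, -, ⟨h2, rfl⟩ | ⟨h2, h3, rfl⟩⟩
    · exact ⟨by omega, Or.inl ⟨h2, hr⟩⟩
    · exact ⟨h3, Or.inr ⟨h2, hr⟩⟩

theorem range_used_subset (n : ℕ) :
    Finset.range (v.firstLen n + v.lastLen n) ⊆ Finset.range (v.h (n + 1)) := by
  rw [h_succ]
  exact Finset.range_mono (by omega)

theorem pieces_subset (n : ℕ) (S : Finset ℕ) :
    v.pieces n S ⊆ Finset.range (v.h (n + 1)) :=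
  (Finset.filter_subset _ _).trans (range_used_subset n)

theorem levels_pieces {n : ℕ} {S : Finset ℕ} (hS : S ⊆ Finset.range (v.h n)) :
    v.levels (n + 1) (v.pieces n S) = v.levels n S := by
  ext x
  rw [mem_levels, mem_levels]
  constructor
  · rintro ⟨t, ht, hx⟩
    obtain ⟨r, hr, hp⟩ := (mem_pieces hS).1 ht
    exact ⟨r, hr, hp.subset hx⟩
  · rintro ⟨r, hr, hx⟩
    obtain ⟨t, hp, hxt⟩ := exists_isPiece (Finset.mem_range.1 (hS hr)) hx
    exact ⟨t, (mem_pieces hS).2 ⟨r, hr, hp⟩, hxt⟩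

theorem exists_levels_eq {N : ℕ} {S : Finset ℕ} (hS : S ⊆ Finset.range (v.h N)) {n : ℕ}
    (hn : N ≤ n) : ∃ S' ⊆ Finset.range (v.h n), v.levels n S' = v.levels N S := by
  induction n, hn using Nat.le_induction with
  | base => exact ⟨S, hS, rfl⟩
  | succ n _ ih =>
    obtain ⟨S', hS', e⟩ := ih
    exact ⟨_, pieces_subset n S', (levels_pieces hS').trans e⟩

theorem volumeReal_levels {n : ℕ} {S : Finset ℕ} (hS : S ⊆ Finset.range (v.h n)) :
    volume.real (v.levels n S) = S.card * v.w n := by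
  rw [measureReal_def, volume_levels hS]
  simp [(v.w_pos n).le]

theorem card_pieces {n : ℕ} {S : Finset ℕ} (hS : S ⊆ Finset.range (v.h n)) :
    (v.pieces n S).card = v.k n * v.m n * S.card := by
  have h1 := volumeReal_levels (pieces_subset (v := v) n S)
  rw [levels_pieces hS, volumeReal_levels hS, v.w_eq n, ← mul_assoc] at h1
  have h2 := mul_right_cancel₀ (v.w_pos (n + 1)).ne' h1
  rw [mul_comm]
  exact_mod_cast h2.symm

/-! ### The last subcolumns -/

/-- The last subcolumn of `C_n`, as a set of points. -/
def lastPart (v : CutStack) (n : ℕ) : Set ℝ :=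
  v.levels (n + 1) (Finset.Ico (v.firstLen n) (v.firstLen n + v.lastLen n))

theorem Ico_used_subset (n a : ℕ) :
    Finset.Ico a (v.firstLen n + v.lastLen n) ⊆ Finset.range (v.h (n + 1)) := fun _ ht =>
  range_used_subset n (Finset.mem_range.2 (Finset.mem_Ico.1 ht).2)

theorem lastPart_inter_levels {n : ℕ} {S : Finset ℕ} (hS : S ⊆ Finset.range (v.h n)) :
    v.lastPart n ∩ v.levels n S = v.levels (n + 1)
      ((Finset.Ico (v.firstLen n) (v.firstLen n + v.lastLen n)).filter
        fun t => (t - v.firstLen n) % v.h n ∈ S) := by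
  rw [← levels_pieces hS]
  ext x
  simp only [lastPart, Set.mem_inter_iff, mem_levels, Finset.mem_filter]
  constructor
  · rintro ⟨⟨t, ht, hx⟩, t', ht', hx'⟩
    have e := level_disjoint (Finset.mem_range.1 (Ico_used_subset n _ ht))
      (Finset.mem_range.1 (pieces_subset n S ht')) hx hx'
    subst e
    refine ⟨t, ⟨ht, ?_⟩, hx⟩
    have h1 := (Finset.mem_Ico.1 ht).1
    obtain ⟨-, ⟨h2, -⟩ | ⟨-, h2⟩⟩ := Finset.mem_filter.1 ht'
    · omega
    · exact h2
  · rintro ⟨t, ⟨ht, h2⟩, hx⟩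
    have h1 := Finset.mem_Ico.1 ht
    exact ⟨⟨t, ht, hx⟩, t, Finset.mem_filter.2 ⟨Finset.mem_range.2 h1.2, Or.inr ⟨h1.1, h2⟩⟩, hx⟩

theorem card_filter_last {n : ℕ} {S : Finset ℕ} (hS : S ⊆ Finset.range (v.h n)) :
    ((Finset.Ico (v.firstLen n) (v.firstLen n + v.lastLen n)).filter
        fun t => (t - v.firstLen n) % v.h n ∈ S).card = v.m n * S.card := by
  rw [← card_filter_mod_mem hS (v.m n) 0]
  symm
  refine Finset.card_bij (fun i _ => v.firstLen n + i) (fun i hi => ?_)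
    (fun i _ j _ e => by omega) fun y hy => ?_
  · simp only [Finset.mem_filter, Finset.mem_range, Finset.mem_Ico, zero_add] at hi ⊢
    rw [← lastLen.eq_1] at hi
    exact ⟨by omega, by rw [Nat.add_sub_cancel_left]; exact hi.2⟩
  · simp only [Finset.mem_filter, Finset.mem_range, Finset.mem_Ico, zero_add] at hy ⊢
    exact ⟨y - v.firstLen n, ⟨by rw [← lastLen.eq_1]; omega, hy.2⟩, by omega⟩

/-- The last subcolumn of `C_n` takes up the proportion `1 / k_n` of every union of levels. -/
theorem volumeReal_lastPart_inter {n : ℕ} {S : Finset ℕ} (hS : S ⊆ Finset.range (v.h n)) :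
    volume.real (v.lastPart n ∩ v.levels n S) = 1 / v.k n * volume.real (v.levels n S) := by
  have h1 : (v.k n : ℝ) ≠ 0 := by exact_mod_cast (v.k_pos n).ne'
  rw [lastPart_inter_levels hS, volumeReal_levels hS,
    volumeReal_levels ((Finset.filter_subset _ _).trans (Ico_used_subset n _)),
    card_filter_last hS, v.w_eq n]
  push_cast; field_simp

theorem measurableSet_lastPart (n : ℕ) : MeasurableSet (v.lastPart n) := measurableSet_levels _ _

theorem frequently_volumeReal_inter_lastPart_ge
    (hps : Tendsto (fun n => ∑ i ∈ Finset.range n, 1 / (v.k i : ℝ)) atTop atTop) (N : ℕ)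
    {F : Set ℝ} (hF : MeasurableSet F) (hF0 : 0 < volume.real (F ∩ v.column N)) :
    ∃ᶠ n in atTop, 1 / (v.k n : ℝ) * volume.real (F ∩ v.column N) / 2
      ≤ volume.real (F ∩ v.lastPart n) := by
  have hS : Finset.range (v.h N) ⊆ Finset.range (v.h N) := subset_rfl
  have hC : v.levels N (Finset.range (v.h N)) = v.column N := levels_range N
  have hCm : MeasurableSet (v.column N) := by rw [← hC]; exact measurableSet_levels _ _
  have hCt : volume (v.column N) ≠ ⊤ := by
    rw [← hC, volume_levels hS]; exact ENNReal.mul_ne_top (by simp) (by simp)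
  set ν := volume.restrict (v.column N)
  have hνa : ∀ A, ν.real A = volume.real (A ∩ v.column N) := fun A =>
    measureReal_restrict_apply' hCm
  have : IsFiniteMeasure ν := ⟨by simpa [ν] using hCt.lt_top⟩
  have key := frequently_measureReal_inter_ge (ν := ν) (Z := v.lastPart)
    (p := fun n => 1 / (v.k n : ℝ)) measurableSet_lastPart hps (N := N) ?_ ?_ hF
    (by rw [hνa]; exact hF0)
  · refine key.mono fun n hn => ?_
    rw [hνa, hνa] at hn
    refine hn.trans (measureReal_mono Set.inter_subset_left ?_)
    refine ne_top_of_le_ne_top ?_ (measure_mono Set.inter_subset_right)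
    rw [lastPart, volume_levels (Ico_used_subset _ _)]
    exact ENNReal.mul_ne_top (by simp) (by simp)
  · intro n hn
    obtain ⟨S, hS', e⟩ := exists_levels_eq hS hn
    rw [hC] at e
    rw [hνa, hνa, Set.univ_inter, ← e, volumeReal_lastPart_inter hS']
  · intro n n' hn hnn
    obtain ⟨S, hS', e⟩ := exists_levels_eq hS hn
    rw [hC] at e
    have hS1 := (Finset.filter_subset (fun t => (t - v.firstLen n) % v.h n ∈ S) _).trans
      (Ico_used_subset (v := v) n (v.firstLen n))
    obtain ⟨S2, hS2, e2⟩ := exists_levels_eq hS1 hnn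
    rw [← lastPart_inter_levels hS'] at e2
    rw [hνa, hνa, Set.univ_inter, ← e, Set.inter_comm (v.lastPart n), Set.inter_assoc, ← e2,
      volumeReal_lastPart_inter hS2, e2, volumeReal_lastPart_inter hS']
    ring

/-! ### Visits to a union of levels up to time `H_n` -/

theorem H_le_firstLen {n : ℕ} (hk : 2 ≤ v.k n) : v.H n ≤ v.firstLen n := by
  unfold firstLen
  have : 1 ≤ v.m n * (v.k n - 1) := Nat.mul_pos (v.m_pos n) (by omega)
  nlinarith

theorem visits_levels {n t H : ℕ} {P : Finset ℕ} (hP : P ⊆ Finset.range (v.h n))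
    (ht : t + H ≤ v.h n) {x : ℝ} (hx : x ∈ v.level n t) :
    visits v.T (v.levels n P) H x = ((Finset.range H).filter fun i => t + i ∈ P).card := by
  rw [visits, Finset.card_filter, Nat.cast_sum]
  refine Finset.sum_congr rfl fun i hi => ?_
  have hi' := Finset.mem_range.1 hi
  have h1 := mem_levels_iff hP (by omega) (iterate_T_mem (by omega : t + i < v.h n) hx)
  by_cases h : t + i ∈ P
  · simp [h1.2 h, h]
  · simp [h1.not.2 h, h]

/-- A window of `H_n` consecutive levels of `C_{n+1}` meets at most `(1 + q) |S|` pieces of levels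
in `S`, where `H_n = q h_n`, and at most `|S|` if it lies in the stack of the first subcolumns. -/
theorem card_window_le {n q : ℕ} (hq : v.H n = q * v.h n) {S : Finset ℕ}
    (hS : S ⊆ Finset.range (v.h n)) (t : ℕ) :
    ((Finset.range (v.H n)).filter fun i => t + i ∈ v.pieces n S).card
      ≤ S.card + if v.firstLen n < t + v.H n then q * S.card else 0 := by
  have hSH : S ⊆ Finset.range (v.H n) := hS.trans (Finset.range_mono (v.h_le_H n))
  have c1 := card_filter_mod_mem hSH 1 t
  rw [one_mul, one_mul] at c1
  split_ifs with hA
  · have c2 := card_filter_mod_mem hS q (t + v.firstLen n * (v.h n - 1))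
    rw [← hq] at c2
    rw [← c2]
    nth_rw 1 [← c1]
    refine (Finset.card_le_card fun i hi => ?_).trans (Finset.card_union_le _ _)
    simp only [Finset.mem_union, Finset.mem_filter, pieces, Finset.mem_range] at hi ⊢
    obtain ⟨hi, -, ⟨-, h⟩ | ⟨h1, h⟩⟩ := hi
    · exact Or.inl ⟨hi, h⟩
    · refine Or.inr ⟨hi, ?_⟩
      -- the shift by `firstLen * (h - 1)` stands for the shift by `- firstLen` modulo `h`
      obtain ⟨c, hc⟩ : ∃ c, v.h n = c + 1 := ⟨v.h n - 1, by have := v.h_pos n; omega⟩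
      have e : t + v.firstLen n * (v.h n - 1) + i
          = t + i - v.firstLen n + v.firstLen n * v.h n := by
        rw [hc, Nat.add_sub_cancel, mul_add, mul_one]; omega
      rwa [e, Nat.add_mul_mod_self_right]
  · rw [← c1, add_zero]
    refine Finset.card_le_card fun i hi => ?_
    simp only [Finset.mem_filter, pieces, Finset.mem_range] at hi ⊢
    obtain ⟨hi, -, ⟨-, h⟩ | ⟨h1, -⟩⟩ := hi
    · exact ⟨hi, h⟩
    · omega

theorem card_filter_pieces_le {n : ℕ} {S : Finset ℕ} (hS : S ⊆ Finset.range (v.h n)) :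
    ((v.pieces n S).filter fun t => v.firstLen n < t + v.H n).card ≤ (1 + v.m n) * S.card := by
  have hSH : S ⊆ Finset.range (v.H n) := hS.trans (Finset.range_mono (v.h_le_H n))
  have c1 := card_filter_mod_mem hSH 1 (v.firstLen n - v.H n)
  rw [one_mul] at c1
  have c2 := card_filter_last hS
  rw [add_mul, ← c1, ← c2]
  refine (Finset.card_le_card (t := ((Finset.range (v.H n)).filter fun i =>
    (v.firstLen n - v.H n + i) % v.H n ∈ S).image (v.firstLen n - v.H n + ·) ∪ _)
    fun t ht => ?_).trans ((Finset.card_union_le _ _).trans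
    (Nat.add_le_add_right Finset.card_image_le _))
  simp only [Finset.mem_union, Finset.mem_filter, pieces, Finset.mem_range, Finset.mem_image,
    Finset.mem_Ico] at ht ⊢
  obtain ⟨⟨h0, ⟨h1, h⟩ | ⟨h1, h⟩⟩, h2⟩ := ht
  · have e : v.firstLen n - v.H n + (t - (v.firstLen n - v.H n)) = t := by omega
    exact Or.inl ⟨t - (v.firstLen n - v.H n), ⟨by omega, by rwa [e]⟩, e⟩
  · exact Or.inr ⟨⟨h1, h0⟩, h⟩

/-- Up to time `H_n = q h_n`, most points of a union `E` of levels of `C_n` visit `E` as often as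
there are levels in `E`, and the others, a proportion of order `1 / k_n`, at most `1 + q` times as
often. Hence, if `q ≤ k_n`, the average is comparable to the number of levels. -/
theorem setLIntegral_visits_levels_le {n q : ℕ} (hk : 2 ≤ v.k n) (hq : v.H n = q * v.h n)
    (hqk : q ≤ v.k n) {S : Finset ℕ} (hS : S ⊆ Finset.range (v.h n)) :
    ∫⁻ x in v.levels n S, visits v.T (v.levels n S) (v.H n) x
      ≤ 3 * S.card * volume (v.levels n S) := by
  have hP := pieces_subset (v := v) n S
  have hH := H_le_firstLen hk
  have hs := v.h_succ n
  rw [← levels_pieces hS, setLIntegral_levels hP, volume_levels hP]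
  have step : ∀ t ∈ v.pieces n S, ∫⁻ x in v.level (n + 1) t,
      visits v.T (v.levels (n + 1) (v.pieces n S)) (v.H n) x
      ≤ (S.card + if v.firstLen n < t + v.H n then q * S.card else 0 : ℕ) *
        ENNReal.ofReal (v.w (n + 1)) := by
    intro t ht
    have ht' := Finset.mem_range.1 ((Finset.filter_subset _ _) ht)
    rw [setLIntegral_congr_fun (measurableSet_level _ _)
      (fun x hx => visits_levels hP (by omega) hx), setLIntegral_const, volume_level]
    gcongr
    exact card_window_le hq hS t
  refine (Finset.sum_le_sum step).trans ?_
  rw [← Finset.sum_mul, ← mul_assoc, ← Nat.cast_sum]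
  gcongr
  norm_cast
  rw [Finset.sum_add_distrib, ← Finset.sum_filter, Finset.sum_const, Finset.sum_const,
    card_pieces hS, smul_eq_mul, smul_eq_mul]
  have h1 := card_filter_pieces_le hS
  have hm := v.m_pos n
  calc v.k n * v.m n * S.card * S.card + _ * (q * S.card)
      ≤ v.k n * v.m n * S.card * S.card + (1 + v.m n) * S.card * (v.k n * S.card) := by gcongr
    _ ≤ v.k n * v.m n * S.card * S.card + (v.m n + v.m n) * S.card * (v.k n * S.card) := by
      gcongr; omega
    _ = _ := by ring

/-! ### Visits during the passage through the last subcolumns -/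

/-- Over the stack of copies of the last subcolumn, extended downwards by `H_n` levels, the visit
counts up to time `H_n` integrate to at least `H_n` times the measure of `F` in the subcolumn: each
point of `F` there has all its preimages up to time `H_n` in the extended stack. -/
theorem mul_volume_inter_lastPart_le {n : ℕ} (hk : 2 ≤ v.k n) {F : Set ℝ}
    (hF : MeasurableSet F) :
    v.H n * volume (F ∩ v.lastPart n) ≤ ∫⁻ x in v.levels (n + 1)
      (Finset.Ico (v.firstLen n - v.H n) (v.firstLen n + v.lastLen n)),
        visits v.T F (v.H n) x := by
  have hH := H_le_firstLen hk
  unfold visits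
  have hm : ∀ i, Measurable fun x => F.indicator (1 : ℝ → ℝ≥0∞) (v.T^[i] x) := fun i =>
    (measurable_one.indicator hF).comp (measurable_T.iterate i)
  rw [lintegral_finsetSum _ fun i _ => hm i]
  have : ∀ i ∈ Finset.range (v.H n), volume (F ∩ v.lastPart n) ≤ ∫⁻ x in v.levels (n + 1)
      (Finset.Ico (v.firstLen n - v.H n) (v.firstLen n + v.lastLen n)),
        F.indicator (1 : ℝ → ℝ≥0∞) (v.T^[i] x) := by
    intro i hi
    have hi' := Finset.mem_range.1 hi
    have e : (fun x => F.indicator (1 : ℝ → ℝ≥0∞) (v.T^[i] x)) = (v.T^[i] ⁻¹' F).indicator 1 := by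
      ext x; simp only [Set.indicator, Set.mem_preimage]; rfl
    have hs := v.h_succ n
    rw [e, lintegral_indicator_one ((measurable_T.iterate i) hF),
      Measure.restrict_apply ((measurable_T.iterate i) hF), lastPart,
      volume_inter_levels (Ico_used_subset _ _), volume_inter_levels (Ico_used_subset _ _)]
    calc ∑ s ∈ Finset.Ico (v.firstLen n) (v.firstLen n + v.lastLen n),
          volume (F ∩ v.level (n + 1) s)
        = ∑ s ∈ Finset.Ico (v.firstLen n - i) (v.firstLen n + v.lastLen n - i),
          volume (F ∩ v.level (n + 1) (s + i)) := by
          rw [Finset.sum_Ico_add' (fun s => volume (F ∩ v.level (n + 1) s)),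
            Nat.sub_add_cancel (by omega), Nat.sub_add_cancel (by omega)]
      _ = ∑ s ∈ Finset.Ico (v.firstLen n - i) (v.firstLen n + v.lastLen n - i),
          volume (v.T^[i] ⁻¹' F ∩ v.level (n + 1) s) := by
          refine Finset.sum_congr rfl fun s hs' => ?_
          have := Finset.mem_Ico.1 hs'
          rw [volume_iterate_preimage_inter_level (by omega)]
      _ ≤ _ := by
          refine Finset.sum_le_sum_of_subset ?_
          exact Finset.Ico_subset_Ico (by omega) (by omega)
  refine le_trans ?_ (Finset.sum_le_sum this)
  simp

theorem rpow_mul_volume_inter_lastPart_le (hT : MeasurePreserving v.T v.μ v.μ) {n : ℕ}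
    (hk : 2 ≤ v.k n) (hH : v.H n ≤ v.lastLen n) {F : Set ℝ} (hF : MeasurableSet F) {β : ℝ}
    (hβ : 0 < β) :
    (v.H n * volume (F ∩ v.lastPart n)) ^ (β + 1) ≤
      ENNReal.ofReal (2 * (v.h n * v.w n / v.k n)) ^ β *
        (ENNReal.ofReal (β + 1) * (v.H n * ∫⁻ x in F, visits v.T F (v.H n) x ^ β ∂v.μ)) := by
  have hA := H_le_firstLen hk
  set I := Finset.Ico (v.firstLen n - v.H n) (v.firstLen n + v.lastLen n)
  have hI : I ⊆ Finset.range (v.h (n + 1)) := Ico_used_subset n _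
  have h1 := setLIntegral_visits_rpow_le hT hF hβ (v.H n) (v.levels (n + 1) I)
  rw [μ_restrict (measurableSet_levels _ _) (levels_subset_column hI),
    μ_apply_of_subset (levels_subset_column hI), volume_levels hI] at h1
  refine (ENNReal.rpow_le_rpow (mul_volume_inter_lastPart_le hk hF) (by linarith)).trans
    (h1.trans ?_)
  have h2 : (I.card : ℝ≥0∞) * ENNReal.ofReal (v.w (n + 1))
      ≤ ENNReal.ofReal (2 * (v.h n * v.w n / v.k n)) := by
    rw [← ENNReal.ofReal_natCast, ← ENNReal.ofReal_mul (by positivity)]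
    apply ENNReal.ofReal_le_ofReal
    have hw := v.w_pos (n + 1)
    have hc : I.card ≤ 2 * (v.h n * v.m n) := by
      have : v.lastLen n = v.h n * v.m n := mul_comm _ _
      simp only [I, Nat.card_Ico]; omega
    calc (I.card : ℝ) * v.w (n + 1) ≤ (2 * (v.h n * v.m n) : ℕ) * v.w (n + 1) := by gcongr
      _ = _ := by rw [mul_div_assoc, w_div_k]; push_cast; ring
  gcongr

end CutStack

/-! ### Comparison of the integrals -/

theorem visitRatio_congr_ae {Ω : Type*} [MeasurableSpace Ω] {μ : Measure Ω} {T : Ω → Ω}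
    (hT : MeasurePreserving T μ μ) (β : ℝ) {F G : Set Ω} (hFG : F =ᵐ[μ] G) (n : ℕ) :
    visitRatio μ T β F n = visitRatio μ T β G n := by
  have h : ∀ᵐ x ∂μ, visits T F n x = visits T G n x := by
    have h1 : ∀ i, ∀ᵐ x ∂μ, T^[i] x ∈ F ↔ T^[i] x ∈ G := fun i =>
      (hT.iterate i).quasiMeasurePreserving.ae hFG.mem_iff
    filter_upwards [ae_all_iff.2 h1] with x hx
    refine Finset.sum_congr rfl fun i _ => ?_
    by_cases hi : T^[i] x ∈ G
    · rw [Set.indicator_of_mem hi, Set.indicator_of_mem ((hx i).2 hi)]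
    · rw [Set.indicator_of_notMem hi, Set.indicator_of_notMem (mt (hx i).1 hi)]
  unfold visitRatio
  rw [Measure.restrict_congr_set hFG]
  have h1 : ∫⁻ x in G, visits T F n x ∂μ = ∫⁻ x in G, visits T G n x ∂μ :=
    lintegral_congr_ae (ae_restrict_of_ae h)
  have h2 : ∫⁻ x in G, visits T F n x ^ β ∂μ = ∫⁻ x in G, visits T G n x ^ β ∂μ :=
    lintegral_congr_ae (ae_restrict_of_ae (h.mono fun x hx => congrArg (· ^ β) hx))
  rw [h1, h2]

/-- The comparison of `q f` with the lower bound `d` for the integral of the `β`-th powers, once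
the common factors have been cancelled; `f w = V` is the measure of a column. -/
theorem mul_le_of_rpow_le {β h w k q c d V f : ℝ} (hβ : 0 < β) (hh : 0 < h) (hw : 0 < w)
    (hk : 0 < k) (hq : 0 < q) (hc : 0 < c) (hd : 0 ≤ d) (hf : 0 ≤ f) (hV : f * w = V)
    (H : (q * h * (1 / k * c / 2)) ^ (β + 1) ≤
      (2 * (h * w / k)) ^ β * ((β + 1) * (q * h * d))) :
    q * f ≤ (2 ^ β * 2 ^ (β + 1) * (β + 1) * V ^ β / c ^ (β + 1)) ^ (1 / β) * k ^ (1 / β) *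
      d ^ (1 / β) := by
  have hV0 : 0 ≤ V := hV ▸ by positivity
  have key : (q * f) ^ β ≤ 2 ^ β * 2 ^ (β + 1) * (β + 1) * V ^ β / c ^ (β + 1) * k * d := by
    have e1 : (q * h * (1 / k * c / 2)) ^ (β + 1)
        = (q * (q * h ^ β * h)) * (q ^ β * c ^ (β + 1) / (2 ^ (β + 1) * (q * k ^ β * k))) := by
      rw [show q * h * (1 / k * c / 2) = (q * h * c) / (2 * k) by field_simp,
        Real.div_rpow (by positivity) (by positivity), Real.mul_rpow (by positivity) hc.le,
        Real.mul_rpow hq.le hh.le, Real.mul_rpow zero_le_two hk.le, Real.rpow_add_one hq.ne',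
        Real.rpow_add_one hh.ne', Real.rpow_add_one hk.ne']
      field_simp
    have e2 : (2 * (h * w / k)) ^ β * ((β + 1) * (q * h * d))
        = (q * (q * h ^ β * h)) * (2 ^ β * w ^ β * (β + 1) * d / (q * k ^ β)) := by
      rw [Real.mul_rpow zero_le_two (by positivity), Real.div_rpow (by positivity) hk.le,
        Real.mul_rpow hh.le hw.le]
      field_simp
    rw [e1, e2] at H
    have H2 := le_of_mul_le_mul_left H (by positivity)
    rw [div_le_div_iff₀ (by positivity) (by positivity)] at H2
    have H3 : q ^ β * c ^ (β + 1) ≤ 2 ^ β * w ^ β * (β + 1) * d * (2 ^ (β + 1) * k) := by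
      refine le_of_mul_le_mul_left (a := q * k ^ β) ?_ (by positivity)
      linarith
    have H4 := mul_le_mul_of_nonneg_right H3 (Real.rpow_nonneg hf β)
    rw [div_mul_eq_mul_div, div_mul_eq_mul_div, le_div_iff₀ (by positivity), ← hV,
      Real.mul_rpow hq.le hf, Real.mul_rpow hf hw.le]
    linarith
  have hA : 0 ≤ 2 ^ β * 2 ^ (β + 1) * (β + 1) * V ^ β / c ^ (β + 1) := by positivity
  calc q * f = ((q * f) ^ β) ^ (1 / β) := by
        rw [← Real.rpow_mul (by positivity), mul_one_div_cancel hβ.ne', Real.rpow_one]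
    _ ≤ (2 ^ β * 2 ^ (β + 1) * (β + 1) * V ^ β / c ^ (β + 1) * k * d) ^ (1 / β) := by gcongr
    _ = _ := by rw [Real.mul_rpow (by positivity) hd, Real.mul_rpow hA hk.le]

theorem tendsto_rpow_div_floor {α β : ℝ} (hβ : 0 < β) (hαβ : 1 < α * β) :
    Tendsto (fun n : ℕ => ((n : ℝ) + 1) ^ (1 / β) / (1 + (⌊(n : ℝ) ^ α⌋₊ : ℝ))) atTop (𝓝 0) := by
  have hpos : 0 < α - 1 / β := by
    rw [sub_pos, div_lt_iff₀ hβ]; exact hαβ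
  have h1 : Tendsto (fun n : ℕ => (2 : ℝ) ^ (1 / β) * (n : ℝ) ^ (-(α - 1 / β))) atTop (𝓝 0) := by
    simpa using ((tendsto_rpow_neg_atTop hpos).comp
      tendsto_natCast_atTop_atTop).const_mul ((2 : ℝ) ^ (1 / β))
  refine squeeze_zero' (Eventually.of_forall fun n => by positivity) ?_ h1
  filter_upwards [eventually_ge_atTop 1] with n hn
  have hn' : (1 : ℝ) ≤ n := by exact_mod_cast hn
  have hn0 : (0 : ℝ) < n := by linarith
  rw [div_le_iff₀ (by positivity)]
  calc ((n : ℝ) + 1) ^ (1 / β) ≤ (2 * n) ^ (1 / β) := by gcongr; linarith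
    _ = 2 ^ (1 / β) * (n : ℝ) ^ (-(α - 1 / β)) * (n : ℝ) ^ α := by
      rw [Real.mul_rpow zero_le_two hn0.le, mul_assoc, ← Real.rpow_add hn0]
      congr 2; ring
    _ ≤ _ := by
      gcongr
      linarith [Nat.lt_floor_add_one ((n : ℝ) ^ α)]

namespace CutStack

variable {v : CutStack}

theorem tendsto_w (hk : ∀ n, v.k n = n + 1) : Tendsto v.w atTop (𝓝 0) := by
  have step : ∀ n, v.w (n + 1) ≤ v.w n / (n + 1) := by
    intro n
    have hm : (1 : ℝ) ≤ v.m n := by exact_mod_cast v.m_pos n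
    have hw := (v.w_pos n).le
    have e : v.w (n + 1) = v.w n / ((n + 1) * v.m n) := by simp [w, hk]
    rw [e]
    gcongr
    exact le_mul_of_one_le_right (by positivity) hm
  have le_one : ∀ n, v.w n ≤ 1 := by
    intro n
    induction n with
    | zero => simp [w]
    | succ n ih =>
      refine (step n).trans ((div_le_self (v.w_pos n).le ?_).trans ih)
      linarith [(n.cast_nonneg : (0 : ℝ) ≤ n)]
  rw [← tendsto_add_atTop_iff_nat 1]
  refine squeeze_zero (fun n => (v.w_pos _).le) (fun n => (step n).trans ?_)
    (tendsto_one_div_add_atTop_nhds_zero_nat (𝕜 := ℝ))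
  gcongr
  exact le_one n

theorem tendsto_H : Tendsto v.H atTop atTop := by
  refine tendsto_atTop_mono (fun n => ?_) tendsto_id
  refine le_trans ?_ (v.h_le_H n)
  induction n with
  | zero => simp
  | succ n ih =>
    have h1 : v.h n ≤ v.lastLen n := Nat.le_mul_of_pos_left _ (v.m_pos n)
    have := v.h_pos n
    rw [h_succ]
    simp only [id] at *
    omega

theorem tendsto_μ_diff_column {F : Set ℝ} (hF : MeasurableSet F) (hF1 : v.μ F ≠ ⊤) :
    Tendsto (fun n => v.μ (F \ v.column n)) atTop (𝓝 0) := by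
  have hC : ∀ n, MeasurableSet (v.column n) := fun n => by
    rw [← levels_range]; exact measurableSet_levels _ _
  have h := tendsto_measure_iInter_atTop (μ := v.μ) (s := fun n => F \ v.column n)
    (fun n => (hF.diff (hC n)).nullMeasurableSet)
    (fun a b hab => Set.sdiff_subset_sdiff_right (column_mono hab))
    ⟨0, ne_top_of_le_ne_top hF1 (measure_mono Set.sdiff_subset)⟩
  have e : v.μ (⋂ n, F \ v.column n) = 0 := by
    rw [μ_apply, ← Set.sdiff_iUnion, ← X.eq_1, Set.sdiff_inter_self]
    exact measure_empty
  rwa [e] at h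

/-- Infinitely often, the integral of the visit counts up to time `H_n` is small compared with the
`β`-norm of the visit counts. -/
theorem frequently_setLIntegral_visits_le {α β : ℝ} (hα1 : α < 1) (hβ : 1 < β)
    (hαβ : 1 < α * β) (hv : v ∈ VAlpha α) (hT : MeasurePreserving v.T v.μ v.μ) {F : Set ℝ}
    (hF : MeasurableSet F) (hF0 : v.μ F ≠ 0) (hF1 : v.μ F ≠ ⊤) {ε : ℝ} (hε : 0 < ε) :
    ∃ᶠ n in atTop, ∫⁻ x in F, visits v.T F (v.H n) x ∂v.μ ≤
      ENNReal.ofReal ε * (∫⁻ x in F, visits v.T F (v.H n) x ^ β ∂v.μ) ^ (1 / β) := by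
  obtain ⟨hk, hl, hm⟩ := hv
  have hβ0 : 0 < β := by linarith
  have i1 : 0 ≤ 1 / β := by positivity
  have i2 : 0 < 1 - 1 / β := by
    rw [sub_pos, div_lt_one hβ0]; exact hβ
  have hdiff := tendsto_μ_diff_column hF hF1
  -- a column that contains most of `F`
  obtain ⟨N, hN1, hN2⟩ : ∃ N, 6 * (v.μ (F \ v.column N) ^ (1 - 1 / β) *
      ENNReal.ofReal (β + 1) ^ (1 / β)) ≤ ENNReal.ofReal (ε / 2) ∧
      v.μ (F \ v.column N) < v.μ F := by
    have t1 : Tendsto (fun n => 6 * (v.μ (F \ v.column n) ^ (1 - 1 / β) *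
        ENNReal.ofReal (β + 1) ^ (1 / β))) atTop (𝓝 0) := by
      have t2 := ENNReal.Tendsto.mul_const (b := ENNReal.ofReal (β + 1) ^ (1 / β))
        (hdiff.ennrpow_const (1 - 1 / β))
        (Or.inr (ENNReal.rpow_ne_top_of_nonneg i1 ENNReal.ofReal_ne_top))
      have t3 := ENNReal.Tendsto.const_mul (a := 6) t2 (Or.inr ENNReal.ofNat_ne_top)
      rwa [ENNReal.zero_rpow_of_pos i2, zero_mul, mul_zero] at t3
    have h1 := t1.eventually_le_const (u := ENNReal.ofReal (ε / 2)) (by simpa using hε)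
    have h2 := hdiff.eventually_lt_const (pos_iff_ne_zero.2 hF0)
    exact (h1.and h2).exists
  have hS : Finset.range (v.h N) ⊆ Finset.range (v.h N) := subset_rfl
  have hC : v.levels N (Finset.range (v.h N)) = v.column N := levels_range N
  have hCm : MeasurableSet (v.column N) := by rw [← hC]; exact measurableSet_levels _ _
  have hCt : volume (v.column N) ≠ ⊤ := by
    rw [← hC, volume_levels hS]; exact ENNReal.mul_ne_top (by simp) (by simp)
  have hFC : v.μ (F ∩ v.column N) ≠ 0 := by
    intro h0
    have := measure_inter_add_sdiff (μ := v.μ) F hCm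
    rw [h0, zero_add] at this
    exact hN2.ne this
  rw [μ_apply_of_subset Set.inter_subset_right] at hFC
  have hFCt : volume (F ∩ v.column N) ≠ ⊤ :=
    ne_top_of_le_ne_top hCt (measure_mono Set.inter_subset_right)
  set c := volume.real (F ∩ v.column N)
  have hc : 0 < c := ENNReal.toReal_pos hFC hFCt
  set V := volume.real (v.column N) with hVdef
  have hps : Tendsto (fun n => ∑ i ∈ Finset.range n, 1 / (v.k i : ℝ)) atTop atTop := by
    simpa [hk] using Real.tendsto_sum_range_one_div_nat_succ_atTop
  have hfreq := frequently_volumeReal_inter_lastPart_ge hps N hF hc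
  set Q := (2 ^ β * 2 ^ (β + 1) * (β + 1) * V ^ β / c ^ (β + 1)) ^ (1 / β) with hQ
  have hsmall : ∀ᶠ n : ℕ in atTop,
      18 * V * Q * (((n : ℝ) + 1) ^ (1 / β) / (1 + (⌊(n : ℝ) ^ α⌋₊ : ℝ))) < ε / 2 := by
    have := (tendsto_rpow_div_floor hβ0 hαβ).const_mul (18 * V * Q)
    rw [mul_zero] at this
    exact this.eventually_lt_const (by linarith)
  have hml := hm.eventually_lt_const (zero_lt_one' ℝ)
  refine (hfreq.and_eventually (hsmall.and (hml.and
    ((eventually_ge_atTop 1).and (eventually_ge_atTop N))))).mono ?_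
  rintro n ⟨hZ, hs, hmn, hn1, hnN⟩
  set q := 1 + ⌊(n : ℝ) ^ α⌋₊ with hqdef
  have hk2 : 2 ≤ v.k n := by rw [hk]; omega
  have hHq : v.H n = q * v.h n := by rw [H, hl, hqdef]; ring
  have hqk : q ≤ v.k n := by
    rw [hk, hqdef, add_comm]
    gcongr
    apply Nat.floor_le_of_le
    have hn1' : (1 : ℝ) ≤ n := by exact_mod_cast hn1
    calc (n : ℝ) ^ α ≤ (n : ℝ) ^ (1 : ℝ) := Real.rpow_le_rpow_of_exponent_le hn1' hα1.le
      _ = n := Real.rpow_one _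
  have hqm : q ≤ v.m n := by
    have hm0 : (0 : ℝ) < v.m n := by exact_mod_cast v.m_pos n
    rw [div_lt_one hm0] at hmn
    have : ⌊(n : ℝ) ^ α⌋₊ < v.m n := by exact_mod_cast hmn
    omega
  have hHlast : v.H n ≤ v.lastLen n := by
    rw [hHq]; exact Nat.mul_le_mul_right _ hqm
  obtain ⟨S, hS', hSe⟩ := exists_levels_eq hS hnN
  rw [hC] at hSe
  set D := ∫⁻ x in F, visits v.T F (v.H n) x ^ β ∂v.μ
  have hDt : D ≠ ⊤ := by
    refine ne_top_of_le_ne_top (b := (v.H n : ℝ≥0∞) ^ β * v.μ F) ?_ ?_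
    · exact ENNReal.mul_ne_top (ENNReal.rpow_ne_top_of_nonneg hβ0.le (by simp)) hF1
    · rw [← setLIntegral_const]
      exact lintegral_mono fun x => ENNReal.rpow_le_rpow (visits_le _ _ _ _) hβ0.le
  have hh0 : (0 : ℝ) < v.h n := by exact_mod_cast v.h_pos n
  have hk0 : (0 : ℝ) < v.k n := by exact_mod_cast v.k_pos n
  have hq0 : (0 : ℝ) < q := by simp only [hqdef]; positivity
  have hw0 := v.w_pos n
  -- the lower bound for `D`
  have hlow : (q * v.h n * (1 / v.k n * c / 2)) ^ (β + 1) ≤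
      (2 * (v.h n * v.w n / v.k n)) ^ β * ((β + 1) * (q * v.h n * D.toReal)) := by
    have h1 := rpow_mul_volume_inter_lastPart_le hT hk2 hHlast hF hβ0
    have h2 := ENNReal.toReal_mono (ENNReal.mul_ne_top
      (ENNReal.rpow_ne_top_of_nonneg hβ0.le ENNReal.ofReal_ne_top)
      (ENNReal.mul_ne_top ENNReal.ofReal_ne_top (ENNReal.mul_ne_top (by simp) hDt))) h1
    rw [← ENNReal.toReal_rpow, ENNReal.toReal_mul, ENNReal.toReal_mul, ENNReal.toReal_mul,
      ENNReal.toReal_mul, ← ENNReal.toReal_rpow, ENNReal.toReal_ofReal (by positivity),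
      ENNReal.toReal_ofReal (by positivity), ENNReal.toReal_natCast, ← measureReal_def, hHq,
      Nat.cast_mul] at h2
    refine le_trans ?_ h2
    gcongr
  have hV : (S.card : ℝ) * v.w n = V := by rw [← volumeReal_levels hS', hSe]
  have hqf := mul_le_of_rpow_le hβ0 hh0 hw0 hk0 hq0 hc ENNReal.toReal_nonneg
    (Nat.cast_nonneg _) hV hlow
  rw [← hQ] at hqf
  -- the upper bound for the visits of the part of `F` in the column
  have hup : 6 * ∫⁻ x in F ∩ v.column N, visits v.T (F ∩ v.column N) (v.H n) x ∂v.μ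
      ≤ ENNReal.ofReal (ε / 2) * D ^ (1 / β) := by
    have h1 : ∫⁻ x in F ∩ v.column N, visits v.T (F ∩ v.column N) (v.H n) x ∂v.μ
        ≤ 3 * S.card * volume (v.column N) := by
      have h2 := setLIntegral_visits_levels_le hk2 hHq hqk hS'
      rw [hSe] at h2
      refine le_trans ?_ h2
      rw [μ_restrict (hF.inter hCm) Set.inter_subset_right]
      refine lintegral_mono' (Measure.restrict_mono Set.inter_subset_right le_rfl) fun x => ?_
      refine Finset.sum_le_sum fun i _ => ?_
      exact Set.indicator_le_indicator_of_subset Set.inter_subset_right (by simp) _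
    have h3 : 18 * (S.card * V) ≤ ε / 2 * D.toReal ^ (1 / β) := by
      have hkn : (v.k n : ℝ) = (n : ℝ) + 1 := by rw [hk]; push_cast; rfl
      have hqn : (q : ℝ) = 1 + (⌊(n : ℝ) ^ α⌋₊ : ℝ) := by rw [hqdef]; push_cast; rfl
      rw [← hqn, ← hkn] at hs
      have hV0 : 0 ≤ V := measureReal_nonneg
      have h4 : (S.card : ℝ) ≤ Q * v.k n ^ (1 / β) * D.toReal ^ (1 / β) / q := by
        rw [le_div_iff₀ hq0, mul_comm]; exact hqf
      calc 18 * (S.card * V)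
          ≤ 18 * (Q * v.k n ^ (1 / β) * D.toReal ^ (1 / β) / q * V) := by gcongr
        _ = 18 * V * Q * ((v.k n : ℝ) ^ (1 / β) / q) * D.toReal ^ (1 / β) := by ring
        _ ≤ _ := by gcongr
    calc _ ≤ 6 * (3 * S.card * volume (v.column N)) := by gcongr
      _ = ENNReal.ofReal (18 * (S.card * V)) := by
        rw [ENNReal.ofReal_mul (by norm_num), ENNReal.ofReal_mul (by positivity),
          ENNReal.ofReal_natCast, hVdef, ofReal_measureReal hCt]
        norm_num
        ring
      _ ≤ ENNReal.ofReal (ε / 2 * D.toReal ^ (1 / β)) := ENNReal.ofReal_le_ofReal h3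
      _ = _ := by
        rw [ENNReal.ofReal_mul (by positivity),
          ← ENNReal.ofReal_rpow_of_nonneg ENNReal.toReal_nonneg i1, ENNReal.ofReal_toReal hDt]
  have hHn : v.H n ≠ 0 := (v.H_pos n).ne'
  calc _ ≤ _ := setLIntegral_visits_le hT hF hCm hβ hHn
    _ ≤ ENNReal.ofReal (ε / 2) * D ^ (1 / β) + ENNReal.ofReal (ε / 2) * D ^ (1 / β) := by
      refine add_le_add hup ?_
      rw [ENNReal.mul_rpow_of_nonneg _ _ i1, ← mul_assoc, ← mul_assoc, mul_assoc 6]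
      gcongr
    _ = _ := by
      rw [← add_mul, ← ENNReal.ofReal_add (by positivity) (by positivity), add_halves]

end CutStack

theorem theorem3p2 (α β : ℝ) (hα0 : 0 < α) (hα1 : α < 1) (hαβ : 1 < α * β)
    (v : CutStack) (hv : v ∈ CutStack.VAlpha α) :
    (∀ F : Set ℝ, MeasureTheory.NullMeasurableSet F v.μ → v.μ F ≠ 0 → v.μ F ≠ ⊤ →
      Filter.liminf (fun n : ℕ => visitRatio v.μ v.T β F (v.H n)) Filter.atTop = 0) ∧
    ¬ RationallyErgodic v.μ v.T β := by
  have hβ : 1 < β := by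
    by_contra! h
    nlinarith
  have hβ0 : 0 < β := by linarith
  have hT := CutStack.measurePreserving_T (CutStack.tendsto_w hv.1)
  have main : ∀ F : Set ℝ, NullMeasurableSet F v.μ → v.μ F ≠ 0 → v.μ F ≠ ⊤ →
      liminf (fun n : ℕ => visitRatio v.μ v.T β F (v.H n)) atTop = 0 := by
    intro G hG hG0 hG1
    obtain ⟨F, -, hF, hFG⟩ := hG.exists_measurable_superset_ae_eq
    simp only [visitRatio_congr_ae hT β hFG.symm]
    rw [← measure_congr hFG] at hG0 hG1
    refine le_antisymm (ENNReal.le_of_forall_pos_le_add fun ε hε _ => ?_) zero_le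
    rw [zero_add]
    have hε' : (0 : ℝ) < (ε : ℝ) ^ (1 / β) := Real.rpow_pos_of_pos hε _
    refine liminf_le_of_frequently_le'
      ((CutStack.frequently_setLIntegral_visits_le hα1 hβ hαβ hv hT hF hG0 hG1 hε').mono
        fun n hn => ?_)
    refine ENNReal.div_le_of_le_mul ?_
    refine (ENNReal.rpow_le_rpow hn hβ0.le).trans_eq ?_
    rw [ENNReal.mul_rpow_of_nonneg _ _ hβ0.le, ← ENNReal.rpow_mul, one_div_mul_cancel hβ0.ne',
      ENNReal.rpow_one, ENNReal.ofReal_rpow_of_nonneg hε'.le hβ0.le,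
      ← Real.rpow_mul ε.coe_nonneg, one_div_mul_cancel hβ0.ne', Real.rpow_one,
      ENNReal.ofReal_coe_nnreal]
  refine ⟨main, ?_⟩
  rintro ⟨-, -, F, hF, hF0, hF1, hlim⟩
  have h1 : liminf (fun n : ℕ => visitRatio v.μ v.T β F n) atTop
      ≤ liminf (fun n : ℕ => visitRatio v.μ v.T β F (v.H n)) atTop :=
    liminf_le_liminf_of_le (f := atTop) (g := map v.H atTop) CutStack.tendsto_H
  rw [main F hF hF0 hF1] at h1
  exact absurd hlim (not_lt.2 h1)
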